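/- **Setting.** A radio hyper-graph on a finite vertex set $V$ is a set of hyper-arcs $e=(\mathrm{Org}(e),\mathrm{Dst}(e))$ with $\mathrm{Org}(e)$ a single vertex and $\mathrm{Dst}(e)$ a non-empty set of other vertices; it is $k$-uniform if $|\mathrm{Dst}(e)|=k$ for every hyper-arc. The simple random walk starts at $X(0)=v$; at each time $t=0,1,2,\dots$ it chooses $e(t)$ uniformly among the hyper-arcs with origin $X(t)$, and then $X(t+1)$ uniformly in $\mathrm{Dst}(e(t))$. A vertex $u$ hears the walk at time $t$ if $u\in \mathrm{Org}(e(t))\cup\mathrm{Dst}(e(t))$; let $\widetilde T_v^u=\inf\{t\in\mathbb N: u \text{ hears the walk at time } t\}$. The radio cover time is $$\widetilde C=\max_{v\in V}\mathbb E\Big[\max_{u\in V}\widetilde T_v^u\Big].$$ For integers $s,r\ge 1$ and $n=s^2$, the $r$-hop two-dimensional mesh radio hyper-graph has vertex set the torus $(\mathbb Z/s\mathbb Z)^2$, and each vertex $v$ is the origin of one hyper-arc, whose destinations are all vertices other than $v$ at $L_1$-distance at most $r$ from $v$ on the torus (if there is no such vertex, $v$ has no hyper-arc). Each such hyper-graph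 is $k$-uniform for some $k$; one has $k=2r(r+1)\le n/2$ when $2r+1\le s$. **Theorem.** Let $\widetilde C$ be the radio cover time of a $k$-uniform two-dimensional mesh radio hyper-graph on $n$ vertices, with $4\le k\le n$. 1. For every $\varepsilon>0$ there is a constant $C_\varepsilon$, depending only on $\varepsilon$, such that whenever $k\le(1-\varepsilon)n$, $$\widetilde C\le C_\varepsilon\,\frac nk\,\log\frac nk\,\log n .$$ 2. There is an absolute constant $C$ such that, for all $4\le k\le n$, $$\widetilde C\le C\,\max\Big\{1,\ \frac nk\,\log\frac nk\,\log n\Big\}.$$ -/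

import Mathlib

open MeasureTheory ProbabilityTheory
open scoped ENNReal

noncomputable section

/-- A hyper-arc on `V`: an ordered pair of non-empty finite sets of vertices,
its origin and its destination. -/
@[ext]
structure HyperArc (V : Type*) where
  org : Finset V
  dst : Finset V
  org_nonempty : org.Nonempty
  dst_nonempty : dst.Nonempty

instance HyperArc.instFinite (V : Type*) [Finite V] : Finite (HyperArc V) :=
  Finite.of_injective (fun e : HyperArc V => (e.org, e.dst)) (fun e f h => by
    have h2 := Prod.mk.inj h
    exact HyperArc.ext h2.1 h2.2)

/-- The vertex `v` belongs to the hyper-arc `e` (the incidence relation). -/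
def HyperArc.Incident {V : Type*} (e : HyperArc V) (v : V) : Prop :=
  v ∈ e.org ∨ v ∈ e.dst

/-- A directed hyper-graph on the vertex set `V` is a set of hyper-arcs. -/
structure DirectedHypergraph (V : Type*) where
  arcs : Set (HyperArc V)

/-- A radio hyper-graph: every hyper-arc has exactly one origin (the transmitter), which is not
among its destinations (the receivers). -/
structure RadioHypergraph (V : Type*) extends DirectedHypergraph V where
  card_org : ∀ e ∈ arcs, e.org.card = 1
  disjoint_org_dst : ∀ e ∈ arcs, Disjoint e.org e.dst

/-- `k`-uniformity of a radio hyper-graph: all hyper-arcs have exactly `k` destinations. -/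
def RadioHypergraph.IsUniform {V : Type*} (H : RadioHypergraph V) (k : ℕ) : Prop :=
  ∀ e ∈ H.arcs, e.dst.card = k

/-- A state of the random walk on a hyper-graph at time `t`: the current node `X(t)`, and the
hyper-arc `e(t)` along which the walk leaves it. -/
structure WalkState (V : Type*) where
  pos : V
  arc : HyperArc V

instance WalkState.instFinite (V : Type*) [Finite V] : Finite (WalkState V) :=
  Finite.of_injective (fun x : WalkState V => (x.pos, x.arc)) (fun x y h => by
    cases x; cases y; simpa using h)

/-- The discrete sigma-algebra. -/
instance WalkState.instMeasurableSpace (V : Type*) : MeasurableSpace (WalkState V) := ⊤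

instance WalkState.instDiscrete (V : Type*) : DiscreteMeasurableSpace (WalkState V) where
  forall_measurableSet _ := trivial

namespace DirectedHypergraph

variable {V : Type*} [Finite V]

/-- The hyper-arcs that leave the vertex `v`. -/
def outArcs (H : DirectedHypergraph V) (v : V) : Finset (HyperArc V) :=
  (Set.toFinite {e | e ∈ H.arcs ∧ v ∈ e.org}).toFinset

open Classical in
/-- The law of the hyper-arc used at the vertex `v`: uniform among the hyper-arcs that leave `v`.
(By convention the walk stays for ever at a vertex that no hyper-arc leaves.) -/
def arcLaw (H : DirectedHypergraph V) (v : V) : PMF (HyperArc V) :=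
  if h : (H.outArcs v).Nonempty then PMF.uniformOfFinset (H.outArcs v) h
  else PMF.pure ⟨{v}, {v}, Finset.singleton_nonempty v, Finset.singleton_nonempty v⟩

/-- The law of the state of the walk at a time when it is located at `v`. -/
def stateLaw (H : DirectedHypergraph V) (v : V) : PMF (WalkState V) :=
  (H.arcLaw v).map (fun e => ⟨v, e⟩)

/-- One step of the simple random walk: the next node is uniform among the destinations of the
current hyper-arc, and the next hyper-arc is uniform among those that leave that node. -/
def stepLaw (H : DirectedHypergraph V) (x : WalkState V) : PMF (WalkState V) :=
  (PMF.uniformOfFinset x.arc.dst x.arc.dst_nonempty).bind H.stateLaw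

/-- The transition kernel of the walk. -/
def stepKernel (H : DirectedHypergraph V) : Kernel (WalkState V) (WalkState V) :=
  Kernel.ofFunOfCountable (fun x => (H.stepLaw x).toMeasure)

instance (H : DirectedHypergraph V) : IsMarkovKernel H.stepKernel :=
  ⟨fun x => PMF.toMeasure.isProbabilityMeasure (H.stepLaw x)⟩

/-- The transition kernel of the walk, reading the last state of the history up to time `t`. -/
def histKernel (H : DirectedHypergraph V) (t : ℕ) :
    Kernel ((i : Finset.Iic t) → (fun _ : ℕ => WalkState V) i) (WalkState V) :=
  H.stepKernel.comap (fun x => x ⟨t, Finset.mem_Iic.2 le_rfl⟩) (measurable_pi_apply _)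

instance (H : DirectedHypergraph V) (t : ℕ) : IsMarkovKernel (H.histKernel t) := by
  unfold histKernel
  infer_instance

/-- The law, on the space of infinite trajectories, of the simple random walk started at `v`. -/
def walkMeasure (H : DirectedHypergraph V) (v : V) : Measure (ℕ → WalkState V) :=
  Kernel.trajMeasure (X := fun _ => WalkState V) (H.stateLaw v).toMeasure H.histKernel

end DirectedHypergraph

/-- The radio hitting time of `u` along a trajectory: the first time `t` at which the hyper-arc
`e(t)` used by the walk contains `u` (`∞` if there is none). -/
def radioHitTime {V : Type*} (u : V) (ω : ℕ → WalkState V) : ℝ≥0∞ :=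
  ⨅ (t : ℕ) (_ : (ω t).arc.Incident u), (t : ℝ≥0∞)

/-- The time by which all vertices have heard the walk, along a trajectory. -/
def radioCoverRandomTime {V : Type*} (ω : ℕ → WalkState V) : ℝ≥0∞ :=
  ⨆ u : V, radioHitTime u ω

/-- The radio cover time: the expected time until all vertices have heard the simple random walk,
maximized over the starting vertex. -/
def DirectedHypergraph.radioCoverTime {V : Type*} [Finite V] (H : DirectedHypergraph V) : ℝ≥0∞ :=
  ⨆ v : V, ∫⁻ ω, radioCoverRandomTime ω ∂(H.walkMeasure v)

/-- The `L₁`-distance on the `s × s` torus. -/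
def torusDist {s : ℕ} (x y : ZMod s × ZMod s) : ℕ :=
  (x.1 - y.1).valMinAbs.natAbs + (x.2 - y.2).valMinAbs.natAbs

/-- The `r`-hop two-dimensional mesh radio hyper-graph on the `s × s` torus: each node `v` is the
origin of one hyper-arc, whose destinations are all the other nodes at `L₁`-distance at most `r`
(there is no hyper-arc if there are no such nodes). -/
def torusMesh (s r : ℕ) : RadioHypergraph (ZMod s × ZMod s) where
  arcs := {e | ∃ v, e.org = {v} ∧ ∀ u, u ∈ e.dst ↔ u ≠ v ∧ torusDist v u ≤ r}
  card_org := by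
    rintro e ⟨v, hv, -⟩
    simp [hv]
  disjoint_org_dst := by
    rintro e ⟨v, hv, hd⟩
    simp [hv, hd]

end

/-! Every vertex of the mesh is the origin of a single hyper-arc, so the positions form a Markov
chain that jumps uniformly in a punctured ball of radius `r`, and `u` hears the walk at time `t`
exactly when the position at time `t` is within distance `r` of `u`. The task is to hit all these
balls.

Fix `u` and suppose `2 * r + 1 ≤ s`. As in the plane, the logarithm of the distance to `u` is almost
harmonic: with x the displacement from `u`, log(|x|² - 5r²) is a supermartingale for jumps from |x|
≥ 4r (`sum_diamond_log_le`), while |x|² grows on average by at least a constant times k per jump.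
Hence 2s² log((|x|² - 5r²)/r²) - |x|² loses at least a constant times k per jump
(`jumpAvg_meshPot_le`). The factor 2s² makes this potential increasing over the whole torus, so that
wrapping around only lowers it. It is at most 2s² log(s²/r²), so a time of order (n/k) log(9n/k)
brings the walk within Euclidean distance 4r of `u` with probability at least 1/2. From there a
bounded number of jumps towards `u` succeeds with probability bounded below (`avoidProb_ball_le`);
for larger `r` this last stage suffices by itself. Order log n such rounds and a union bound over
`u` finish the estimate (`radioCoverTime_le_of_avoidProb_le`).

When k ≤ (1 - ε)n, log(n/k) is at least ε, so the constant 9 and the additive terms are absorbed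
(`exists_radioCoverTime_le`). For the uniform bound, either a fraction 1/1600 of the vertices is out
of range of each transmitter (`card_meshDst_le_of_lt`), or `r` is so close to `s` that the vertices
missed by a transmitter cluster near its antipode; two consecutive transmissions then inform
everyone with probability at least 1/2 (`chainProb_unheard_le`), and the cover time is at most 2. -/

noncomputable section

/-! ### From the trajectory measure to finite averages along the chain -/

open Classical in
/-- The probability that the first `j` steps `(X i, X (i + 1))` of the chain that jumps from `v` to
a uniform element of `dst v` all satisfy the relation `R`. -/
def chainProb {V : Type*} (dst : V → Finset V) (R : V → V → Prop) : ℕ → V → ℝ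
  | 0, _ => 1
  | j + 1, v => (∑ y ∈ dst v, if R v y then chainProb dst R j y else 0) / (dst v).card

lemma chainProb_nonneg {V : Type*} (dst : V → Finset V) (R : V → V → Prop) (j : ℕ) (v : V) :
    0 ≤ chainProb dst R j v := by
  induction j generalizing v with
  | zero => simp [chainProb]
  | succ j ih =>
    rw [chainProb]
    refine div_nonneg (Finset.sum_nonneg fun y _ => ?_) (Nat.cast_nonneg _)
    split_ifs
    exacts [ih y, le_rfl]

namespace DirectedHypergraph

variable {V : Type*} [Finite V] (H : DirectedHypergraph V)

lemma lintegral_walkMeasure_zero (v : V) (f : WalkState V → ℝ≥0∞) :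
    ∫⁻ ω, f (ω 0) ∂(H.walkMeasure v) = ∫⁻ x, f x ∂(H.stateLaw v).toMeasure := by
  have hmap : (H.walkMeasure v).map (fun ω => ω 0) = (H.stateLaw v).toMeasure := by
    have hf : (fun ω : ℕ → WalkState V => ω 0) =
        (fun x : (i : Finset.Iic 0) → (fun _ : ℕ => WalkState V) i =>
          x ⟨0, Finset.mem_Iic.2 le_rfl⟩) ∘ Preorder.frestrictLe 0 := rfl
    rw [hf, ← Measure.map_map (measurable_pi_apply _) (by fun_prop), walkMeasure,
      Kernel.trajMeasure, Measure.map_comp _ _ (by fun_prop),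
      Kernel.traj_map_frestrictLe_of_le le_rfl, Measure.deterministic_comp_eq_map,
      Measure.map_map (measurable_pi_apply _) (by fun_prop),
      Measure.map_map (by fun_prop) (by fun_prop)]
    convert Measure.map_id using 2
    ext x
    simp only [Function.comp_apply, id]
    rfl
  rw [← hmap, lintegral_map (measurable_of_finite f) (measurable_pi_apply 0)]

instance (v : V) : IsProbabilityMeasure (H.walkMeasure v) := by
  have := PMF.toMeasure.isProbabilityMeasure (H.stateLaw v)
  unfold walkMeasure
  infer_instance

/-- The Markov property: `histKernel` reads only the last state of the history. -/
lemma lintegral_walkMeasure_succ (v : V) (j : ℕ)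
    (F : ((i : Finset.Iic j) → (fun _ : ℕ => WalkState V) i) → WalkState V → ℝ≥0∞) :
    ∫⁻ ω, F (Preorder.frestrictLe j ω) (ω (j + 1)) ∂(H.walkMeasure v) =
      ∫⁻ ω, ∫⁻ y, F (Preorder.frestrictLe j ω) y ∂(H.stepLaw (ω j)).toMeasure
        ∂(H.walkMeasure v) := by
  have := PMF.toMeasure.isProbabilityMeasure (H.stateLaw v)
  have key := Kernel.map_frestrictLe_trajMeasure_compProd_eq_map_trajMeasure
    (X := fun _ => WalkState V) (μ₀ := (H.stateLaw v).toMeasure) (κ := H.histKernel) (a := j)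
  have hmeas : Measurable (fun z : ((i : Finset.Iic j) → (fun _ : ℕ => WalkState V) i) ×
      WalkState V => F z.1 z.2) := by
    have : Countable ((i : Finset.Iic j) → (fun _ : ℕ => WalkState V) i) :=
      Finite.to_countable
    exact measurable_of_countable _
  have h1 := lintegral_map (μ := H.walkMeasure v) hmeas
    (g := fun x => (Preorder.frestrictLe j x, x (j + 1))) (by fun_prop)
  simp only at h1
  rw [← h1, walkMeasure, ← key, Measure.lintegral_compProd hmeas, lintegral_map]
  · rfl
  · exact Measurable.lintegral_kernel_prod_right' hmeas
  · fun_prop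

open Classical in
/-- One step of the walk, on functions of the state, restricted to steps that satisfy `R`. -/
def stepOp (R : WalkState V → WalkState V → Prop) (f : WalkState V → ℝ≥0∞) (x : WalkState V) :
    ℝ≥0∞ :=
  ∫⁻ y, (if R x y then f y else 0) ∂(H.stepLaw x).toMeasure

-- The induction peels off the last step: conditioning on the history up to time j turns `f` into
-- `stepOp R f`.
open Classical in
lemma lintegral_walkMeasure_chain (v : V) (R : WalkState V → WalkState V → Prop) (j : ℕ)
    (f : WalkState V → ℝ≥0∞) :
    ∫⁻ ω, (if ∀ i < j, R (ω i) (ω (i + 1)) then f (ω j) else 0) ∂(H.walkMeasure v) =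
      ∫⁻ x, ((H.stepOp R)^[j] f) x ∂(H.stateLaw v).toMeasure := by
  induction j generalizing f with
  | zero => simpa using H.lintegral_walkMeasure_zero v f
  | succ j ih =>
    rw [Function.iterate_succ_apply, ← ih]
    have h := H.lintegral_walkMeasure_succ v j (fun h y =>
      if (∀ i, ∀ hi : i < j, R (h ⟨i, Finset.mem_Iic.2 hi.le⟩) (h ⟨i + 1, Finset.mem_Iic.2 hi⟩)) ∧
        R (h ⟨j, Finset.mem_Iic.2 le_rfl⟩) y then f y else 0)
    simp only [Preorder.frestrictLe_apply] at h
    convert h using 3 with ω ω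
    · exact if_congr Nat.forall_lt_succ_right rfl rfl
    · by_cases hR : ∀ i < j, R (ω i) (ω (i + 1))
      · rw [if_pos hR, stepOp]
        simp only [and_iff_right hR]
      · rw [if_neg hR]
        simp only [hR, false_and, if_false, lintegral_zero]

variable {arcAt : V → HyperArc V}

lemma lintegral_stepLaw (hH : ∀ v, H.stateLaw v = PMF.pure ⟨v, arcAt v⟩) (x : WalkState V)
    (g : WalkState V → ℝ≥0∞) :
    ∫⁻ y, g y ∂(H.stepLaw x).toMeasure =
      (∑ y ∈ x.arc.dst, g ⟨y, arcAt y⟩) / x.arc.dst.card := by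
  classical
  have : Fintype V := Fintype.ofFinite V
  let : MeasurableSpace V := ⊤
  have : DiscreteMeasurableSpace V := ⟨fun _ => trivial⟩
  have h1 : H.stepLaw x = (PMF.uniformOfFinset x.arc.dst x.arc.dst_nonempty).map
      (fun y => (⟨y, arcAt y⟩ : WalkState V)) := by
    rw [stepLaw, ← PMF.bind_pure_comp]
    congr 1
    funext y
    exact hH y
  rw [h1, ← PMF.toMeasure_map (f := fun y => (⟨y, arcAt y⟩ : WalkState V)) _ (measurable_of_finite _),
    lintegral_map (measurable_of_finite g) (measurable_of_finite _), lintegral_fintype]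
  simp only [PMF.toMeasure_apply_singleton _ _ (MeasurableSet.singleton _),
    PMF.uniformOfFinset_apply, mul_ite, mul_zero]
  rw [← Finset.sum_filter, Finset.filter_mem_eq_inter, Finset.univ_inter, ← Finset.sum_mul,
    ENNReal.div_eq_inv_mul, mul_comm]

/-- The probability that the first `j` steps of the walk satisfy `R`. -/
lemma walkMeasure_chain (hH : ∀ v, H.stateLaw v = PMF.pure ⟨v, arcAt v⟩)
    (R : WalkState V → WalkState V → Prop) (j : ℕ) (v : V) :
    H.walkMeasure v {ω | ∀ i < j, R (ω i) (ω (i + 1))} =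
      ENNReal.ofReal (chainProb (fun v => (arcAt v).dst)
        (fun x y => R ⟨x, arcAt x⟩ ⟨y, arcAt y⟩) j v) := by
  classical
  have hmeas : MeasurableSet {ω : ℕ → WalkState V | ∀ i < j, R (ω i) (ω (i + 1))} := by
    have : {ω : ℕ → WalkState V | ∀ i < j, R (ω i) (ω (i + 1))} =
        ⋂ i, ⋂ (_ : i < j), (fun ω => (ω i, ω (i + 1))) ⁻¹'
          {p : WalkState V × WalkState V | R p.1 p.2} := by
      ext; simp
    rw [this]
    refine MeasurableSet.iInter fun i => MeasurableSet.iInter fun _ =>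
      Measurable.prodMk (measurable_pi_apply _) (measurable_pi_apply _) ?_
    exact (Set.toFinite _).measurableSet
  have h := H.lintegral_walkMeasure_chain v R j (fun _ => 1)
  rw [← lintegral_indicator_one hmeas]
  have e1 : ∫⁻ ω, ({ω | ∀ i < j, R (ω i) (ω (i + 1))} : Set (ℕ → WalkState V)).indicator 1 ω
      ∂(H.walkMeasure v) =
      ∫⁻ ω, (if ∀ i < j, R (ω i) (ω (i + 1)) then 1 else 0) ∂(H.walkMeasure v) := by
    refine lintegral_congr fun ω => ?_
    simp [Set.indicator_apply]
  rw [e1, h, hH, PMF.toMeasure_pure, lintegral_dirac]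
  clear h e1 hmeas
  induction j generalizing v with
  | zero => simp [chainProb]
  | succ j ih =>
    rw [Function.iterate_succ_apply', stepOp, lintegral_stepLaw H hH, chainProb]
    have hc : (0 : ℝ) < (arcAt v).dst.card := by
      exact_mod_cast (arcAt v).dst_nonempty.card_pos
    rw [ENNReal.ofReal_div_of_pos hc, ENNReal.ofReal_natCast, ENNReal.ofReal_sum_of_nonneg]
    · congr 1
      refine Finset.sum_congr rfl fun y _ => ?_
      split_ifs
      · exact ih y
      · simp
    · intro y _
      split_ifs
      exacts [chainProb_nonneg _ _ _ _, le_rfl]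

end DirectedHypergraph

/-! ### The expected cover time as a sum of tail probabilities -/

open Classical in
lemma radioCoverRandomTime_le_tsum {V : Type*} (ω : ℕ → WalkState V) :
    radioCoverRandomTime ω ≤
      ∑' t : ℕ, if ∃ u, ∀ i < t + 1, ¬ (ω i).arc.Incident u then (1 : ℝ≥0∞) else 0 := by
  refine iSup_le fun u => ?_
  by_cases h : ∃ t, (ω t).arc.Incident u
  · have h1 : radioHitTime u ω ≤ (Nat.find h : ℝ≥0∞) :=
      iInf₂_le (f := fun (t : ℕ) (_ : (ω t).arc.Incident u) => (t : ℝ≥0∞)) _ (Nat.find_spec h)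
    refine h1.trans ?_
    calc (Nat.find h : ℝ≥0∞) = ∑ t ∈ Finset.range (Nat.find h), 1 := by simp
      _ ≤ ∑ t ∈ Finset.range (Nat.find h),
          if ∃ u, ∀ i < t + 1, ¬ (ω i).arc.Incident u then (1 : ℝ≥0∞) else 0 := by
        refine Finset.sum_le_sum fun t ht => ?_
        rw [if_pos ⟨u, fun i hi => Nat.find_min h (by have := Finset.mem_range.1 ht; omega)⟩]
      _ ≤ _ := ENNReal.sum_le_tsum _
  · push Not at h
    have : (∑' t : ℕ, if ∃ u, ∀ i < t + 1, ¬ (ω i).arc.Incident u then (1 : ℝ≥0∞) else 0)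
        = ∑' t : ℕ, 1 := tsum_congr fun t => if_pos ⟨u, fun i _ => h i⟩
    rw [this, ENNReal.tsum_const_eq_top_of_ne_zero one_ne_zero]
    exact le_top

namespace DirectedHypergraph

lemma lintegral_radioCoverRandomTime_le {V : Type*} [Finite V] (H : DirectedHypergraph V) (v : V) :
    ∫⁻ ω, radioCoverRandomTime ω ∂(H.walkMeasure v) ≤
      ∑' t : ℕ, H.walkMeasure v {ω | ∃ u, ∀ i < t + 1, ¬ (ω i).arc.Incident u} := by
  classical
  refine (lintegral_mono radioCoverRandomTime_le_tsum).trans ?_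
  have hmeas : ∀ t : ℕ, MeasurableSet
      {ω : ℕ → WalkState V | ∃ u, ∀ i < t + 1, ¬ (ω i).arc.Incident u} := by
    intro t
    have : {ω : ℕ → WalkState V | ∃ u, ∀ i < t + 1, ¬ (ω i).arc.Incident u} =
        ⋃ u, ⋂ i, ⋂ (_ : i < t + 1), (fun ω => ω i) ⁻¹' {x | ¬ x.arc.Incident u} := by
      ext; simp
    rw [this]
    have : Countable V := Finite.to_countable
    exact MeasurableSet.iUnion fun u => MeasurableSet.iInter fun i => MeasurableSet.iInter fun _ =>
      measurable_pi_apply _ (MeasurableSet.of_discrete)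
  rw [lintegral_tsum]
  · refine le_of_eq (tsum_congr fun t => ?_)
    rw [← lintegral_indicator_one (hmeas t)]
    refine lintegral_congr fun ω => ?_
    simp [Set.indicator_apply]
  · intro t
    exact (Measurable.ite (hmeas t) measurable_const measurable_const).aemeasurable

end DirectedHypergraph

/-! ### Avoidance probabilities of a chain with uniform jumps -/

section Chain

variable {V : Type*} {dst : V → Finset V}

/-- The average of `f` after one jump of the chain. -/
def jumpAvg (dst : V → Finset V) (f : V → ℝ) (v : V) : ℝ :=
  (∑ y ∈ dst v, f y) / (dst v).card

lemma jumpAvg_mono {f g : V → ℝ} {v : V} (h : ∀ y ∈ dst v, f y ≤ g y) :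
    jumpAvg dst f v ≤ jumpAvg dst g v :=
  div_le_div_of_nonneg_right (Finset.sum_le_sum h) (Nat.cast_nonneg _)

lemma jumpAvg_const (hd : ∀ v, (dst v).Nonempty) (c : ℝ) (v : V) :
    jumpAvg dst (fun _ => c) v = c := by
  have : ((dst v).card : ℝ) ≠ 0 := by exact_mod_cast (hd v).card_pos.ne'
  simp only [jumpAvg, Finset.sum_const, nsmul_eq_mul]
  field_simp

lemma jumpAvg_add (f g : V → ℝ) (v : V) :
    jumpAvg dst (fun y => f y + g y) v = jumpAvg dst f v + jumpAvg dst g v := by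
  simp only [jumpAvg, Finset.sum_add_distrib, add_div]

lemma jumpAvg_mul_left (c : ℝ) (f : V → ℝ) (v : V) :
    jumpAvg dst (fun y => c * f y) v = c * jumpAvg dst f v := by
  simp only [jumpAvg, ← Finset.mul_sum, mul_div_assoc]

open Classical in
lemma chainProb_succ (R : V → V → Prop) (j : ℕ) (v : V) :
    chainProb dst R (j + 1) v =
      jumpAvg dst (fun y => if R v y then chainProb dst R j y else 0) v := rfl

open Classical in
lemma chainProb_one (R : V → V → Prop) (v : V) :
    chainProb dst R 1 v = ((dst v).filter (R v)).card / (dst v).card := by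
  simp [chainProb]

lemma chainProb_le_one (hd : ∀ v, (dst v).Nonempty) (R : V → V → Prop) (j : ℕ) (v : V) :
    chainProb dst R j v ≤ 1 := by
  induction j generalizing v with
  | zero => simp [chainProb]
  | succ j ih =>
    rw [chainProb_succ, ← jumpAvg_const hd 1 v]
    refine jumpAvg_mono fun y _ => ?_
    split_ifs
    exacts [ih y, zero_le_one]

/-- If `M` steps in a row satisfy `R` with probability at most `γ`, whatever the start. -/
lemma chainProb_add_le {R : V → V → Prop} {M : ℕ} {γ : ℝ}
    (h : ∀ v, chainProb dst R M v ≤ γ) (j : ℕ) (v : V) :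
    chainProb dst R (j + M) v ≤ γ * chainProb dst R j v := by
  induction j generalizing v with
  | zero => simpa [chainProb] using h v
  | succ j ih =>
    rw [show j + 1 + M = j + M + 1 by ring, chainProb_succ, chainProb_succ, ← jumpAvg_mul_left]
    refine jumpAvg_mono fun y _ => ?_
    split_ifs
    exacts [ih y, by simp]

lemma chainProb_mul_le_pow (hd : ∀ v, (dst v).Nonempty) {R : V → V → Prop} {M : ℕ} {γ : ℝ}
    (hγ : 0 ≤ γ) (h : ∀ v, chainProb dst R M v ≤ γ) (i j : ℕ) (v : V) :
    chainProb dst R (i * M + j) v ≤ γ ^ i := by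
  induction i generalizing v with
  | zero => simpa using chainProb_le_one hd R j v
  | succ i ih =>
    rw [show (i + 1) * M + j = i * M + j + M by ring, pow_succ']
    exact (chainProb_add_le h _ v).trans (mul_le_mul_of_nonneg_left (ih v) hγ)

lemma chainProb_antitone (hd : ∀ v, (dst v).Nonempty) (R : V → V → Prop) (v : V) :
    Antitone fun j => chainProb dst R j v := by
  refine antitone_nat_of_succ_le fun j => ?_
  have := chainProb_add_le (R := R) (M := 1) (γ := 1) (fun v => chainProb_le_one hd R 1 v) j v
  simpa using this

/-- The probability that the chain started at `v` avoids `A` at the times `0, …, j - 1`. -/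
def avoidProb (dst : V → Finset V) (A : Set V) (j : ℕ) (v : V) : ℝ :=
  chainProb dst (fun x _ => x ∉ A) j v

variable {A B : Set V}

lemma avoidProb_succ_of_mem {v : V} (h : v ∈ A) (j : ℕ) : avoidProb dst A (j + 1) v = 0 := by
  simp [avoidProb, chainProb, h]

lemma avoidProb_succ_of_notMem {v : V} (h : v ∉ A) (j : ℕ) :
    avoidProb dst A (j + 1) v = jumpAvg dst (avoidProb dst A j) v := by
  simp only [avoidProb, chainProb_succ, h, not_false_eq_true, if_true]
  rfl

/-- Drift bound: if `h ≥ 0` decreases by `c` on average off `A`, then `A` is hit quickly. -/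
lemma mul_avoidProb_le_of_drift (hd : ∀ v, (dst v).Nonempty) {h : V → ℝ} {c : ℝ} (hc : 0 ≤ c)
    (h0 : ∀ v, 0 ≤ h v) (hdrift : ∀ v ∉ A, jumpAvg dst h v ≤ h v - c) (J : ℕ) (v : V) :
    c * (J * avoidProb dst A J v) ≤ h v := by
  -- With T the hitting time of `A`, the summand is P(T > i), so the sum is E[min(T, J)]. Each
  -- summand is at least P(T ≥ J), which gives the final bound.
  have key : ∀ J v, c * ∑ i ∈ Finset.range J, avoidProb dst A (i + 1) v ≤ h v := by
    intro J
    induction J with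
    | zero => intro v; simpa using h0 v
    | succ J ih =>
      intro v
      by_cases hv : v ∈ A
      · simpa [avoidProb_succ_of_mem hv] using h0 v
      · have e : ∑ i ∈ Finset.range (J + 1), avoidProb dst A (i + 1) v =
            jumpAvg dst (fun y => 1 + ∑ i ∈ Finset.range J, avoidProb dst A (i + 1) y) v := by
          simp only [avoidProb_succ_of_notMem hv]
          rw [Finset.sum_range_succ', jumpAvg_add, jumpAvg_const hd]
          simp only [jumpAvg, ← Finset.sum_div]
          rw [Finset.sum_comm]
          have : ((dst v).card : ℝ) ≠ 0 := by exact_mod_cast (hd v).card_pos.ne'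
          simp [avoidProb, chainProb, this]
          ring
        rw [e, ← jumpAvg_mul_left]
        have h1 : jumpAvg dst
            (fun y => c * (1 + ∑ i ∈ Finset.range J, avoidProb dst A (i + 1) y)) v ≤
            jumpAvg dst (fun y => c + h y) v :=
          jumpAvg_mono fun y _ => by linarith [ih y]
        rw [jumpAvg_add, jumpAvg_const hd] at h1
        linarith [hdrift v hv]
  refine le_trans ?_ (key J v)
  refine mul_le_mul_of_nonneg_left ?_ hc
  have h2 : ∑ i ∈ Finset.range J, avoidProb dst A J v ≤
      ∑ i ∈ Finset.range J, avoidProb dst A (i + 1) v :=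
    Finset.sum_le_sum fun i hi => chainProb_antitone hd _ v (by have := Finset.mem_range.1 hi; omega)
  simpa using h2

open Classical in
/-- If a level function decreases by `δ` with probability at least `p` off `B`, then a start at
level `b + i δ` leads to `B` within `i` steps with probability at least `p ^ i`. -/
lemma avoidProb_le_of_level (hd : ∀ v, (dst v).Nonempty) {D : V → ℝ} {b δ p : ℝ} (hp0 : 0 ≤ p)
    (hp1 : p ≤ 1) (hB : ∀ v, D v ≤ b → v ∈ B)
    (hstep : ∀ v ∉ B, p * (dst v).card ≤ ((dst v).filter fun y => D y ≤ D v - δ).card) (i : ℕ)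
    (v : V) (hv : D v ≤ b + i * δ) : avoidProb dst B (i + 1) v ≤ 1 - p ^ i := by
  -- A path of i jumps visits i + 1 positions, whence the index i + 1.
  induction i generalizing v with
  | zero => simp [avoidProb_succ_of_mem (hB v (by simpa using hv))]
  | succ i ih =>
    by_cases hvB : v ∈ B
    · rw [avoidProb_succ_of_mem hvB]
      linarith [pow_le_one₀ (n := i + 1) hp0 hp1]
    · rw [avoidProb_succ_of_notMem hvB]
      have h1 : jumpAvg dst (avoidProb dst B (i + 1)) v ≤
          jumpAvg dst (fun y => 1 + -(p ^ i) * if D y ≤ D v - δ then 1 else 0) v := by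
        refine jumpAvg_mono fun y _ => ?_
        split_ifs with hy
        · have := ih y (by push_cast at hv; linarith)
          linarith
        · have := chainProb_le_one hd (fun x _ => x ∉ B) (i + 1) y
          simpa [avoidProb] using this
      rw [jumpAvg_add, jumpAvg_const hd, jumpAvg_mul_left] at h1
      have hc : (0 : ℝ) < (dst v).card := by exact_mod_cast (hd v).card_pos
      have h2 : p ≤ jumpAvg dst (fun y => if D y ≤ D v - δ then (1 : ℝ) else 0) v := by
        rw [jumpAvg, le_div_iff₀ hc, Finset.sum_boole]
        exact hstep v hvB
      have := mul_le_mul_of_nonneg_left h2 (pow_nonneg hp0 i)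
      rw [pow_succ]
      linarith

/-- The strong Markov property at the hitting time of `A`: once in `A`, the chain still has at least
`m` steps left to find `B`. -/
lemma avoidProb_add_le_of_reach (hd : ∀ v, (dst v).Nonempty) {m : ℕ} {p : ℝ}
    (h : ∀ v ∈ A, avoidProb dst B m v ≤ 1 - p) (J : ℕ) (v : V) :
    avoidProb dst B (J + m) v ≤ 1 - p * (1 - avoidProb dst A J v) := by
  induction J generalizing v with
  | zero =>
    have := chainProb_le_one hd (fun x _ => x ∉ B) m v
    simpa [avoidProb, chainProb] using this
  | succ J ih =>
    by_cases hA : v ∈ A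
    · rw [avoidProb_succ_of_mem hA]
      have := (chainProb_antitone hd (fun x _ => x ∉ B) v (show m ≤ J + 1 + m by omega)).trans
        (h v hA)
      simpa [avoidProb] using this
    · rw [avoidProb_succ_of_notMem hA]
      have h3 : avoidProb dst B (J + 1 + m) v ≤ jumpAvg dst (avoidProb dst B (J + m)) v := by
        rw [show J + 1 + m = J + m + 1 by ring]
        by_cases hB : v ∈ B
        · rw [avoidProb_succ_of_mem hB]
          exact div_nonneg (Finset.sum_nonneg fun y _ => chainProb_nonneg _ _ _ _)
            (Nat.cast_nonneg _)
        · rw [avoidProb_succ_of_notMem hB]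
      refine h3.trans ((jumpAvg_mono fun y _ => ih y).trans ?_)
      have e : (fun y => 1 - p * (1 - avoidProb dst A J y)) =
          fun y => (1 - p) + p * avoidProb dst A J y := by funext y; ring
      rw [e, jumpAvg_add, jumpAvg_const hd, jumpAvg_mul_left]
      linarith

end Chain

/-! ### Mesh geometry and the approach to a vertex from distance `6 * r` -/

section Torus

variable {s : ℕ}

lemma ZMod.natAbs_valMinAbs_add_le' (a b : ZMod s) :
    (a + b).valMinAbs.natAbs ≤ a.valMinAbs.natAbs + b.valMinAbs.natAbs :=
  (ZMod.natAbs_valMinAbs_add_le a b).trans (Int.natAbs_add_le _ _)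

lemma torusDist_comm (x y : ZMod s × ZMod s) : torusDist x y = torusDist y x := by
  unfold torusDist
  rw [← ZMod.natAbs_valMinAbs_neg (x.1 - y.1), ← ZMod.natAbs_valMinAbs_neg (x.2 - y.2), neg_sub,
    neg_sub]

lemma torusDist_self (x : ZMod s × ZMod s) : torusDist x x = 0 := by
  simp [torusDist]

lemma ZMod.intCast_mul_natCast_inj {e : ℤ} (he : e.natAbs = 1) {i i' : ℕ} (hi : i < s)
    (hi' : i' < s) (h : ((e * i : ℤ) : ZMod s) = ((e * i' : ℤ) : ZMod s)) : i = i' := by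
  have h2 : (i : ZMod s) = i' := by
    rcases Int.natAbs_eq e with h1 | h1 <;> rw [he] at h1 <;> subst h1 <;> simpa using h
  rw [ZMod.natCast_eq_natCast_iff'] at h2
  rwa [Nat.mod_eq_of_lt hi, Nat.mod_eq_of_lt hi'] at h2

variable [NeZero s]

lemma ZMod.natAbs_valMinAbs_intCast_le (i : ℤ) : (i : ZMod s).valMinAbs.natAbs ≤ i.natAbs :=
  ZMod.natAbs_min_of_le_div_two s _ _ (by simp) (ZMod.natAbs_valMinAbs_le _)

lemma torusDist_le (x y : ZMod s × ZMod s) : torusDist x y ≤ s := by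
  have h1 := ZMod.natAbs_valMinAbs_le (x.1 - y.1)
  have h2 := ZMod.natAbs_valMinAbs_le (x.2 - y.2)
  unfold torusDist
  omega

open Classical in
/-- The destinations of the hyper-arc of the mesh with origin `v`. -/
def meshDst (s r : ℕ) [NeZero s] (v : ZMod s × ZMod s) : Finset (ZMod s × ZMod s) :=
  Finset.univ.filter fun u => u ≠ v ∧ torusDist v u ≤ r

variable {r : ℕ}

lemma mem_meshDst {u v : ZMod s × ZMod s} : u ∈ meshDst s r v ↔ u ≠ v ∧ torusDist v u ≤ r := by
  simp [meshDst]

lemma meshDst_nonempty (hs : 2 ≤ s) (hr : 1 ≤ r) (v : ZMod s × ZMod s) :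
    (meshDst s r v).Nonempty := by
  have : Fact (1 < s) := ⟨hs⟩
  refine ⟨(v.1 + 1, v.2), mem_meshDst.2 ⟨fun h => ?_, ?_⟩⟩
  · have := congrArg Prod.fst h
    simp at this
  · have h1 := ZMod.natAbs_valMinAbs_intCast_le (s := s) (-1)
    simp only [Int.reduceNeg, Int.cast_neg, Int.cast_one, IsUnit.neg_iff, isUnit_one,
      Int.natAbs_of_isUnit] at h1
    simp only [torusDist, sub_add_cancel_left, sub_self, ZMod.valMinAbs_zero, Int.natAbs_zero]
    omega

/-- The hyper-arc of the mesh with origin `v`. -/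
def meshArc (hd : ∀ v, (meshDst s r v).Nonempty) (v : ZMod s × ZMod s) :
    HyperArc (ZMod s × ZMod s) :=
  ⟨{v}, meshDst s r v, Finset.singleton_nonempty v, hd v⟩

lemma meshArc_mem (hd : ∀ v, (meshDst s r v).Nonempty) (v : ZMod s × ZMod s) :
    meshArc hd v ∈ (torusMesh s r).arcs :=
  ⟨v, rfl, fun _ => mem_meshDst⟩

lemma incident_meshArc_iff (hd : ∀ v, (meshDst s r v).Nonempty) (u v : ZMod s × ZMod s) :
    (meshArc hd v).Incident u ↔ torusDist v u ≤ r := by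
  by_cases h : u = v
  · simp [HyperArc.Incident, meshArc, h, torusDist_self]
  · simp [HyperArc.Incident, meshArc, h, mem_meshDst]

/-- With one hyper-arc per origin, the state is a function of the position. This is the hypothesis
`hH` of `walkMeasure_chain`. -/
lemma stateLaw_torusMesh (hd : ∀ v, (meshDst s r v).Nonempty) (v : ZMod s × ZMod s) :
    (torusMesh s r).stateLaw v = PMF.pure ⟨v, meshArc hd v⟩ := by
  have h : (torusMesh s r).outArcs v = {meshArc hd v} := by
    ext e
    simp only [DirectedHypergraph.outArcs, Set.Finite.mem_toFinset, Set.mem_ofPred_eq,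
      Finset.mem_singleton]
    constructor
    · rintro ⟨⟨w, hw, hdst⟩, hv⟩
      rw [hw, Finset.mem_singleton] at hv
      subst hv
      refine HyperArc.ext hw ?_
      ext u
      rw [hdst u]
      exact mem_meshDst.symm
    · rintro rfl
      exact ⟨meshArc_mem hd v, by simp [meshArc]⟩
  have h2 : (torusMesh s r).arcLaw v = PMF.pure (meshArc hd v) := by
    rw [DirectedHypergraph.arcLaw, dif_pos (by rw [h]; exact Finset.singleton_nonempty _)]
    ext e
    simp only [PMF.uniformOfFinset_apply, h, PMF.pure_apply, Finset.card_singleton, Nat.cast_one,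
      inv_one]
    by_cases he : e = meshArc hd v
    · rw [if_pos (Finset.mem_singleton.2 he), if_pos he]
    · rw [if_neg (fun h => he (Finset.mem_singleton.1 h)), if_neg he]
  rw [DirectedHypergraph.stateLaw, h2, PMF.pure_map]

lemma card_meshDst_of_isUniform {k : ℕ} (hd : ∀ v, (meshDst s r v).Nonempty)
    (hk : (torusMesh s r).IsUniform k) (v : ZMod s × ZMod s) : (meshDst s r v).card = k :=
  hk _ (meshArc_mem hd v)

lemma card_meshDst_lt (v : ZMod s × ZMod s) : (meshDst s r v).card < s ^ 2 := by
  have h : meshDst s r v ⊂ Finset.univ := by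
    refine Finset.ssubset_univ_iff.2 fun h => ?_
    have := Finset.mem_univ v
    rw [← h, mem_meshDst] at this
    exact this.1 rfl
  have := Finset.card_lt_card h
  simpa [ZMod.card, sq] using this

lemma card_meshDst_le (hr : 1 ≤ r) (v : ZMod s × ZMod s) : (meshDst s r v).card ≤ 9 * r ^ 2 := by
  have h : (meshDst s r v).card ≤
      (Finset.Icc (-r : ℤ) r ×ˢ Finset.Icc (-r : ℤ) r).card := by
    refine Finset.card_le_card_of_injOn
      (fun u => ((v.1 - u.1).valMinAbs, (v.2 - u.2).valMinAbs)) ?_ ?_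
    · intro u hu
      have := (mem_meshDst.1 hu).2
      unfold torusDist at this
      simp only [Finset.coe_product, Finset.coe_Icc, Set.mem_prod, Set.mem_Icc]
      omega
    · intro x _ y _ hxy
      have h1 := ZMod.injective_valMinAbs (Prod.mk.inj hxy).1
      have h2 := ZMod.injective_valMinAbs (Prod.mk.inj hxy).2
      exact Prod.ext (sub_right_injective h1) (sub_right_injective h2)
  refine h.trans ?_
  simp only [Finset.card_product, Int.card_Icc]
  have e : ((r : ℤ) + 1 - -r).toNat = 2 * r + 1 := by omega
  rw [e]
  nlinarith

/-- The sign `e` is opposite to that of the minimal representative of `z`. -/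
lemma ZMod.exists_natAbs_valMinAbs_sub (z : ZMod s) : ∃ e : ℤ, e.natAbs = 1 ∧
    ∀ i : ℕ, i ≤ z.valMinAbs.natAbs →
      (z + ((e * i : ℤ) : ZMod s)).valMinAbs.natAbs + i ≤ z.valMinAbs.natAbs := by
  have key : ∀ (e : ℤ) (i : ℕ), (z + ((e * i : ℤ) : ZMod s)).valMinAbs.natAbs ≤
      (z.valMinAbs + e * i).natAbs := by
    intro e i
    have := ZMod.natAbs_valMinAbs_intCast_le (s := s) (z.valMinAbs + e * i)
    rwa [Int.cast_add, ZMod.coe_valMinAbs] at this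
  rcases le_total 0 z.valMinAbs with h | h
  · refine ⟨-1, rfl, fun i hi => ?_⟩
    have := key (-1) i
    omega
  · refine ⟨1, rfl, fun i hi => ?_⟩
    have := key 1 i
    omega

open Classical in
/-- A positive fraction of the jumps brings the walk closer to `u` by a quarter of the range. -/
lemma card_meshDst_le_card_closer (hr : 1 ≤ r) {u v : ZMod s × ZMod s} (h : r < torusDist v u) :
    (meshDst s r v).card ≤ 576 *
      ((meshDst s r v).filter fun y => 4 * torusDist y u + r ≤ 4 * torusDist v u).card := by
  -- Move by `m - w` to `m` towards `u` along the axis of larger displacement, which is at least `m`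
  -- because the distance exceeds `r`, and by at most `w` along the other axis, possibly away from
  -- `u`. The net gain is at least r/4 and the jump has length at most `r`. This box has (w + 1)² ≥
  -- r²/64 points against at most 9r² destinations, and 576 = 9 · 64.
  set m := r / 2 + 1 with hm
  set w := r / 8 with hw
  have hbox : (w + 1) ^ 2 ≤
      ((meshDst s r v).filter fun y => 4 * torusDist y u + r ≤ 4 * torusDist v u).card := by
    have e1 : (w + 1) ^ 2 = (Finset.Icc (m - w) m ×ˢ Finset.range (w + 1)).card := by
      rw [Finset.card_product, Nat.card_Icc, Finset.card_range,
        show m + 1 - (m - w) = w + 1 by omega, sq]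
    rw [e1]
    have hb : ∀ x y : ZMod s, (x - y).valMinAbs.natAbs ≤ s / 2 :=
      fun x y => ZMod.natAbs_valMinAbs_le _
    have hb1 := hb v.1 u.1
    have hb2 := hb v.2 u.2
    have hrs := h.trans_le (torusDist_le v u)
    have hj : ∀ (x y : ZMod s) (j : ℕ), (x + ((1 * j : ℤ) : ZMod s) - y).valMinAbs.natAbs ≤
        (x - y).valMinAbs.natAbs + j := by
      intro x y j
      have h1 := ZMod.natAbs_valMinAbs_add_le' (x - y) ((1 * j : ℤ) : ZMod s)
      have h2 := ZMod.natAbs_valMinAbs_intCast_le (s := s) (1 * j)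
      rw [show x + ((1 * j : ℤ) : ZMod s) - y = x - y + ((1 * j : ℤ) : ZMod s) by ring]
      omega
    have hself : ∀ (x : ZMod s) (i : ℤ), (x - (x + (i : ZMod s))).valMinAbs.natAbs ≤ i.natAbs := by
      intro x i
      have h2 := ZMod.natAbs_valMinAbs_intCast_le (s := s) (-i)
      rw [show x - (x + (i : ZMod s)) = ((-i : ℤ) : ZMod s) by push_cast; ring]
      omega
    have hne : ∀ (x : ZMod s) (e : ℤ) (i : ℕ), e.natAbs = 1 → 0 < i → i < s →
        x + ((e * i : ℤ) : ZMod s) ≠ x := by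
      intro x e i he hi his hx
      have h0 : ((e * i : ℤ) : ZMod s) = ((e * (0 : ℕ) : ℤ) : ZMod s) := by simpa using hx
      have := ZMod.intCast_mul_natCast_inj he his (by omega) h0
      omega
    obtain ⟨e, he, hcloser⟩ := ZMod.exists_natAbs_valMinAbs_sub (v.1 - u.1)
    obtain ⟨e', he', hcloser'⟩ := ZMod.exists_natAbs_valMinAbs_sub (v.2 - u.2)
    have hmul : ∀ (e : ℤ) (i : ℕ), e.natAbs = 1 → (e * i).natAbs = i := by
      intro e i he
      rw [Int.natAbs_mul, he]
      simp
    have hmem : ∀ x : ℕ × ℕ, x ∈ Finset.Icc (m - w) m ×ˢ Finset.range (w + 1) →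
        (m - w ≤ x.1 ∧ x.1 ≤ m) ∧ x.2 < w + 1 := by
      intro x hx
      simpa using hx
    unfold torusDist at h
    rcases le_total (v.2 - u.2).valMinAbs.natAbs (v.1 - u.1).valMinAbs.natAbs with hab | hab
    · refine Finset.card_le_card_of_injOn
        (fun x => (v.1 + ((e * x.1 : ℤ) : ZMod s), v.2 + ((1 * x.2 : ℤ) : ZMod s))) ?_ ?_
      · intro x hx
        have hx' := hmem x hx
        rw [Finset.mem_coe, Finset.mem_filter, mem_meshDst]
        refine ⟨⟨fun hh => hne v.1 e x.1 he (by omega) (by omega) (congrArg Prod.fst hh), ?_⟩, ?_⟩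
        · have h1 := hself v.1 (e * x.1)
          have h2 := hself v.2 (1 * x.2)
          rw [hmul e _ he] at h1
          rw [hmul 1 _ rfl] at h2
          simp only [torusDist]
          omega
        · have h1 := hcloser x.1 (by omega)
          have h2 := hj v.2 u.2 x.2
          rw [show v.1 - u.1 + ((e * x.1 : ℤ) : ZMod s) = v.1 + ((e * x.1 : ℤ) : ZMod s) - u.1 by
            ring] at h1
          simp only [torusDist]
          omega
      · intro x hx y hy hxy
        have hx' := hmem x hx
        have hy' := hmem y hy
        have h1 := add_left_cancel (Prod.mk.inj hxy).1
        have h2 := add_left_cancel (Prod.mk.inj hxy).2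
        exact Prod.ext (ZMod.intCast_mul_natCast_inj he (by omega) (by omega) h1)
          (ZMod.intCast_mul_natCast_inj rfl (by omega) (by omega) h2)
    · refine Finset.card_le_card_of_injOn
        (fun x => (v.1 + ((1 * x.2 : ℤ) : ZMod s), v.2 + ((e' * x.1 : ℤ) : ZMod s))) ?_ ?_
      · intro x hx
        have hx' := hmem x hx
        rw [Finset.mem_coe, Finset.mem_filter, mem_meshDst]
        refine ⟨⟨fun hh => hne v.2 e' x.1 he' (by omega) (by omega) (congrArg Prod.snd hh), ?_⟩, ?_⟩
        · have h1 := hself v.2 (e' * x.1)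
          have h2 := hself v.1 (1 * x.2)
          rw [hmul e' _ he'] at h1
          rw [hmul 1 _ rfl] at h2
          simp only [torusDist]
          omega
        · have h1 := hcloser' x.1 (by omega)
          have h2 := hj v.1 u.1 x.2
          rw [show v.2 - u.2 + ((e' * x.1 : ℤ) : ZMod s) = v.2 + ((e' * x.1 : ℤ) : ZMod s) - u.2 by
            ring] at h1
          simp only [torusDist]
          omega
      · intro x hx y hy hxy
        have hx' := hmem x hx
        have hy' := hmem y hy
        have h1 := add_left_cancel (Prod.mk.inj hxy).1
        have h2 := add_left_cancel (Prod.mk.inj hxy).2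
        exact Prod.ext (ZMod.intCast_mul_natCast_inj he' (by omega) (by omega) h2)
          (ZMod.intCast_mul_natCast_inj rfl (by omega) (by omega) h1)
  have hc := card_meshDst_le hr v
  have hrw : r ≤ 8 * (w + 1) := by omega
  have := Nat.pow_le_pow_left hrw 2
  nlinarith

/-- From distance at most `6 r`, the walk reaches the ball of radius `r` around `u` within twenty
steps with a probability bounded below. -/
lemma avoidProb_ball_le_of_torusDist_le (hd : ∀ v, (meshDst s r v).Nonempty) (hr : 1 ≤ r)
    {u v : ZMod s × ZMod s} (h : torusDist v u ≤ 6 * r) :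
    avoidProb (meshDst s r) {x | torusDist x u ≤ r} 21 v ≤ 1 - (1 / 576 : ℝ) ^ 20 := by
  classical
  -- Twenty descents by r/4 lead from 6r to r.
  refine avoidProb_le_of_level hd (D := fun x => (torusDist x u : ℝ)) (b := r) (δ := r / 4)
    (by norm_num) (by norm_num) (fun x hx => by simpa using hx) (fun x hx => ?_) 20 v ?_
  · have h1 := card_meshDst_le_card_closer hr (not_le.1 hx)
    have h2 : ((meshDst s r x).filter fun y => 4 * torusDist y u + r ≤ 4 * torusDist x u) =
        ((meshDst s r x).filter fun y => (torusDist y u : ℝ) ≤ (torusDist x u : ℝ) - r / 4) := by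
      refine Finset.filter_congr fun y _ => ?_
      rw [← Nat.cast_le (α := ℝ)]
      push_cast
      constructor <;> intro h <;> linarith
    rw [h2] at h1
    have h3 : ((meshDst s r x).card : ℝ) ≤ 576 * (((meshDst s r x).filter fun y =>
      (torusDist y u : ℝ) ≤ (torusDist x u : ℝ) - r / 4).card : ℝ) := by exact_mod_cast h1
    linarith
  · have : (torusDist v u : ℝ) ≤ 6 * r := by exact_mod_cast h
    push_cast
    linarith

end Torus

/-! ### The logarithmic potential in the plane -/

lemma Real.log_one_add_le_cubic {u : ℝ} (hu : -1 < u) :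
    Real.log (1 + u) ≤ u - u ^ 2 / 2 + u ^ 3 / 3 := by
  -- The derivative x³/(1 + x) of the difference has the sign of x, so the difference is minimal at
  -- 0; the bound thus holds for both signs of u.
  have hder : ∀ x : ℝ, -1 < x → HasDerivAt
      (fun x => x - x ^ 2 / 2 + x ^ 3 / 3 - Real.log (1 + x)) (x ^ 3 / (1 + x)) x := by
    intro x hx
    have hx' : 1 + x ≠ 0 := by linarith
    have h1 := (((hasDerivAt_id x).sub ((hasDerivAt_pow 2 x).div_const 2)).add
      ((hasDerivAt_pow 3 x).div_const 3)).sub (((hasDerivAt_id x).const_add 1).log hx')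
    have e : 1 - ((2 : ℕ) : ℝ) * x ^ (2 - 1) / 2 + ((3 : ℕ) : ℝ) * x ^ (3 - 1) / 3 - 1 / (1 + id x) =
        x ^ 3 / (1 + x) := by
      simp only [id]
      push_cast
      field_simp
      ring
    exact e ▸ h1
  have hcont : ∀ x : ℝ, -1 < x → ContinuousAt
      (fun x => x - x ^ 2 / 2 + x ^ 3 / 3 - Real.log (1 + x)) x := fun x hx =>
    (hder x hx).continuousAt
  suffices h : (fun x => x - x ^ 2 / 2 + x ^ 3 / 3 - Real.log (1 + x)) 0 ≤
      (fun x => x - x ^ 2 / 2 + x ^ 3 / 3 - Real.log (1 + x)) u by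
    simp at h
    linarith
  rcases le_total 0 u with h0 | h0
  · refine monotoneOn_of_deriv_nonneg (convex_Icc 0 u)
      (fun x hx => (hcont x (by linarith [hx.1])).continuousWithinAt)
      (fun x hx => ?_) (fun x hx => ?_) (Set.left_mem_Icc.2 h0) (Set.right_mem_Icc.2 h0) h0
    · rw [interior_Icc] at hx
      exact (hder x (by linarith [hx.1])).differentiableAt.differentiableWithinAt
    · rw [interior_Icc] at hx
      rw [(hder x (by linarith [hx.1])).deriv]
      exact div_nonneg (pow_nonneg hx.1.le 3) (by linarith [hx.1])
  · refine antitoneOn_of_deriv_nonpos (convex_Icc u 0)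
      (fun x hx => (hcont x (by linarith [hx.1])).continuousWithinAt)
      (fun x hx => ?_) (fun x hx => ?_) (Set.left_mem_Icc.2 h0) (Set.right_mem_Icc.2 h0) h0
    · rw [interior_Icc] at hx
      exact (hder x (by linarith [hx.1])).differentiableAt.differentiableWithinAt
    · rw [interior_Icc] at hx
      rw [(hder x (by linarith [hx.1])).deriv]
      exact div_nonpos_of_nonpos_of_nonneg (by nlinarith [hx.2, sq_nonneg x])
        (by linarith [hx.1])

/-- The non-zero integer points of the `L₁`-ball of radius `r`. -/
def diamond (r : ℕ) : Finset (ℤ × ℤ) :=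
  (Finset.Icc (-r : ℤ) r ×ˢ Finset.Icc (-r : ℤ) r).filter
    fun y => y ≠ 0 ∧ y.1.natAbs + y.2.natAbs ≤ r

lemma mem_diamond {r : ℕ} {y : ℤ × ℤ} :
    y ∈ diamond r ↔ y ≠ 0 ∧ y.1.natAbs + y.2.natAbs ≤ r := by
  simp only [diamond, Finset.mem_filter, Finset.mem_product, Finset.mem_Icc, and_iff_right_iff_imp]
  omega

lemma sum_diamond_comp {r : ℕ} (σ : ℤ × ℤ → ℤ × ℤ) (hσ : ∀ y, σ (σ y) = y)
    (hmem : ∀ y ∈ diamond r, σ y ∈ diamond r) (f : ℤ × ℤ → ℝ) :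
    ∑ y ∈ diamond r, f (σ y) = ∑ y ∈ diamond r, f y :=
  Finset.sum_nbij' σ σ hmem hmem (fun y _ => hσ y) (fun y _ => hσ y) (fun _ _ => rfl)

/-- Averaging over the eight symmetries of the diamond. -/
lemma sum_diamond_symm (r : ℕ) (f : ℝ → ℝ → ℝ) :
    ∑ y ∈ diamond r, f y.1 y.2 = ∑ y ∈ diamond r,
      (f y.1 y.2 + f (-y.1) y.2 + f y.1 (-y.2) + f (-y.1) (-y.2) +
        (f y.2 y.1 + f (-y.2) y.1 + f y.2 (-y.1) + f (-y.2) (-y.1))) / 8 := by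
  have neg1 : ∀ g : ℝ → ℝ → ℝ,
      ∑ y ∈ diamond r, g (-y.1) y.2 = ∑ y ∈ diamond r, g y.1 y.2 := by
    intro g
    rw [← sum_diamond_comp (fun y => (-y.1, y.2)) (by simp) _ (fun y => g y.1 y.2)]
    · simp
    · intro y hy
      simpa [mem_diamond, Prod.ext_iff] using hy
  have swap : ∀ g : ℝ → ℝ → ℝ,
      ∑ y ∈ diamond r, g y.2 y.1 = ∑ y ∈ diamond r, g y.1 y.2 := by
    intro g
    rw [← sum_diamond_comp (fun y => (y.2, y.1)) (by simp) _ (fun y => g y.1 y.2)]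
    intro y hy
    simpa [mem_diamond, Prod.ext_iff, and_comm, add_comm] using hy
  have neg2 : ∀ g : ℝ → ℝ → ℝ,
      ∑ y ∈ diamond r, g y.1 (-y.2) = ∑ y ∈ diamond r, g y.1 y.2 := by
    intro g
    exact (swap fun a b => g a (-b)).symm.trans ((neg1 fun a b => g b a).trans (swap g))
  have neg12 : ∀ g : ℝ → ℝ → ℝ,
      ∑ y ∈ diamond r, g (-y.1) (-y.2) = ∑ y ∈ diamond r, g y.1 y.2 := by
    intro g
    rw [neg1 fun a b => g a (-b), neg2]
  rw [← Finset.sum_div]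
  simp only [Finset.sum_add_distrib]
  rw [neg1, neg2, neg12, swap f, swap (fun a b => f (-a) b), swap (fun a b => f a (-b)),
    swap (fun a b => f (-a) (-b)), neg1, neg2, neg12]
  ring

lemma sq_add_sq_le_of_mem_diamond {r : ℕ} {y : ℤ × ℤ} (hy : y ∈ diamond r) :
    (y.1 : ℝ) ^ 2 + (y.2 : ℝ) ^ 2 ≤ r ^ 2 := by
  have h := (mem_diamond.1 hy).2
  have h1 : ((y.1.natAbs : ℝ) + y.2.natAbs) ≤ r := by exact_mod_cast h
  have e : ∀ z : ℤ, (z : ℝ) ^ 2 = (z.natAbs : ℝ) ^ 2 := by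
    intro z
    rw [Nat.cast_natAbs, Int.cast_abs, sq_abs]
  rw [e, e]
  have h2 : (0 : ℝ) ≤ y.1.natAbs := Nat.cast_nonneg _
  have h3 : (0 : ℝ) ≤ y.2.natAbs := Nat.cast_nonneg _
  nlinarith

/-- A jump of length at most `r` from distance at least `4 r` leads to distance at least `3 r`. -/
lemma nine_mul_sq_le_of_jump {r a b c d : ℝ} (hr : 0 ≤ r) (hx : 16 * r ^ 2 ≤ a ^ 2 + b ^ 2)
    (hy : c ^ 2 + d ^ 2 ≤ r ^ 2) : 9 * r ^ 2 ≤ (a + c) ^ 2 + (b + d) ^ 2 := by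
  set A := Real.sqrt (a ^ 2 + b ^ 2) with hA
  have hA2 : A ^ 2 = a ^ 2 + b ^ 2 := Real.sq_sqrt (by positivity)
  have hA0 : 0 ≤ A := Real.sqrt_nonneg _
  have hA4 : 4 * r ≤ A := by
    apply Real.le_sqrt_of_sq_le
    nlinarith
  set B := Real.sqrt (c ^ 2 + d ^ 2) with hB
  have hB2 : B ^ 2 = c ^ 2 + d ^ 2 := Real.sq_sqrt (by positivity)
  have hB0 : 0 ≤ B := Real.sqrt_nonneg _
  have hBr : B ≤ r := Real.sqrt_le_iff.2 ⟨hr, hy⟩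
  have hcs : |a * c + b * d| ≤ A * B := by
    apply abs_le_of_sq_le_sq _ (by positivity)
    rw [mul_pow, hA2, hB2]
    nlinarith [sq_nonneg (a * d - b * c)]
  have h1 := (abs_le.1 hcs).1
  have h2 : 3 * r ≤ A - B := by linarith
  have h3 : (3 * r) ^ 2 ≤ (A - B) ^ 2 := pow_le_pow_left₀ (by positivity) h2 2
  nlinarith

/-- The logarithm of the squared distance, shifted by five times the squared jump range, is a
supermartingale at distances at least four times the jump range. -/
lemma sum_diamond_log_le {r : ℕ} (hr : 1 ≤ r) {a b : ℝ} (hx : 16 * (r : ℝ) ^ 2 ≤ a ^ 2 + b ^ 2) :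
    ∑ y ∈ diamond r, Real.log ((a + y.1) ^ 2 + (b + y.2) ^ 2 - 5 * (r : ℝ) ^ 2) ≤
      (diamond r).card * Real.log (a ^ 2 + b ^ 2 - 5 * (r : ℝ) ^ 2) := by
  have hr' : (1 : ℝ) ≤ r := by exact_mod_cast hr
  set p : ℝ := a ^ 2 + b ^ 2 - 5 * (r : ℝ) ^ 2 with hp
  have hp11 : 11 * (r : ℝ) ^ 2 ≤ p := by linarith
  have hp0 : 0 < p := lt_of_lt_of_le (by positivity) hp11
  let F : ℝ → ℝ → ℝ := fun c d => (2 * (a * c + b * d) + (c ^ 2 + d ^ 2)) / p -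
    ((2 * (a * c + b * d) + (c ^ 2 + d ^ 2)) / p) ^ 2 / 2 +
    ((2 * (a * c + b * d) + (c ^ 2 + d ^ 2)) / p) ^ 3 / 3
  have h1 : ∀ y ∈ diamond r, Real.log ((a + y.1) ^ 2 + (b + y.2) ^ 2 - 5 * (r : ℝ) ^ 2) ≤
      Real.log p + F y.1 y.2 := by
    intro y hy
    have h9 := nine_mul_sq_le_of_jump (by linarith) hx (sq_add_sq_le_of_mem_diamond hy)
    set u : ℝ := (2 * (a * y.1 + b * y.2) + ((y.1 : ℝ) ^ 2 + (y.2 : ℝ) ^ 2)) / p with hu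
    have e : (a + y.1) ^ 2 + (b + y.2) ^ 2 - 5 * (r : ℝ) ^ 2 = p * (1 + u) := by
      rw [mul_add, mul_one, hu, mul_div_cancel₀ _ hp0.ne', hp]
      ring
    have hpos : 0 < 1 + u := by
      have : 0 < p * (1 + u) := by rw [← e]; nlinarith
      exact (mul_pos_iff_of_pos_left hp0).1 this
    rw [e, Real.log_mul hp0.ne' hpos.ne']
    have := Real.log_one_add_le_cubic (u := u) (by linarith)
    simp only [F, ← hu]
    linarith
  have h2 : ∑ y ∈ diamond r, F y.1 y.2 ≤ 0 := by
    -- Averaging over the symmetries leaves only a² + b² and n = |y|². The leading terms n/p and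
    -- -(a² + b²)n/p² would cancel without the shift; with it they leave -5r²n/p², which outweighs
    -- the positive next-order terms.
    rw [sum_diamond_symm]
    refine Finset.sum_nonpos fun y hy => ?_
    have hn := sq_add_sq_le_of_mem_diamond hy
    set n : ℝ := (y.1 : ℝ) ^ 2 + (y.2 : ℝ) ^ 2 with hndef
    have hn0 : 0 ≤ n := by positivity
    have e : (F y.1 y.2 + F (-y.1) y.2 + F y.1 (-y.2) + F (-y.1) (-y.2) +
        (F y.2 y.1 + F (-y.2) y.1 + F y.2 (-y.1) + F (-y.2) (-y.1))) / 8 =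
        n / p ^ 3 * ((p - (a ^ 2 + b ^ 2)) * p - n / 2 * p + 2 * (a ^ 2 + b ^ 2) * n +
          n ^ 2 / 3) := by
      simp only [F]
      field_simp
      rw [hndef]
      ring
    rw [e]
    refine mul_nonpos_of_nonneg_of_nonpos (by positivity) ?_
    have hq : a ^ 2 + b ^ 2 = p + 5 * (r : ℝ) ^ 2 := by rw [hp]; ring
    rw [hq]
    have hR : 0 ≤ (r : ℝ) ^ 2 := by positivity
    generalize (r : ℝ) ^ 2 = R at *
    have m1 : p * n ≤ p * R := mul_le_mul_of_nonneg_left hn hp0.le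
    have m2 : R * n ≤ R * R := mul_le_mul_of_nonneg_left hn hR
    have m3 : n * n ≤ R * R := mul_le_mul hn hn hn0 hR
    have m4 : R * (11 * R) ≤ R * p := mul_le_mul_of_nonneg_left hp11 hR
    linarith [mul_nonneg hR hR]
  calc _ ≤ ∑ y ∈ diamond r, (Real.log p + F y.1 y.2) := Finset.sum_le_sum h1
    _ ≤ _ := by
      rw [Finset.sum_add_distrib, Finset.sum_const, nsmul_eq_mul]
      linarith

lemma sum_diamond_sq (r : ℕ) (a b : ℝ) :
    ∑ y ∈ diamond r, ((a + y.1) ^ 2 + (b + y.2) ^ 2) = (diamond r).card * (a ^ 2 + b ^ 2) +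
      ∑ y ∈ diamond r, ((y.1 : ℝ) ^ 2 + (y.2 : ℝ) ^ 2) := by
  rw [sum_diamond_symm r fun c d => (a + c) ^ 2 + (b + d) ^ 2, ← nsmul_eq_mul,
    ← Finset.sum_const, ← Finset.sum_add_distrib]
  exact Finset.sum_congr rfl fun y _ => by ring

/-- A box of at least r²/64 points, each of squared norm at least r²/16, fits in the diamond. -/
lemma le_sum_diamond_sq {r : ℕ} (hr : 1 ≤ r) :
    (r : ℝ) ^ 4 / 1024 ≤ ∑ y ∈ diamond r, ((y.1 : ℝ) ^ 2 + (y.2 : ℝ) ^ 2) := by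
  set m := r / 2 + 1 with hm
  set w := r / 8 with hw
  have hinj : Set.InjOn (fun x : ℕ × ℕ => ((x.1 : ℤ), (x.2 : ℤ)))
      (Finset.Icc (m - w) m ×ˢ Finset.range (w + 1) : Finset (ℕ × ℕ)) := by
    intro x _ y _ hxy
    simpa [Prod.ext_iff] using hxy
  have hsub : (Finset.Icc (m - w) m ×ˢ Finset.range (w + 1)).image
      (fun x : ℕ × ℕ => ((x.1 : ℤ), (x.2 : ℤ))) ⊆ diamond r := by
    intro y hy
    simp only [Finset.mem_image, Finset.mem_product, Finset.mem_Icc, Finset.mem_range] at hy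
    obtain ⟨x, hx, rfl⟩ := hy
    rw [mem_diamond]
    constructor
    · intro h0
      have := congrArg Prod.fst h0
      simp at this
      omega
    · simp
      omega
  refine le_trans ?_ (Finset.sum_le_sum_of_subset_of_nonneg hsub fun _ _ _ => by positivity)
  rw [Finset.sum_image hinj]
  have hc : (Finset.Icc (m - w) m ×ˢ Finset.range (w + 1)).card = (w + 1) ^ 2 := by
    rw [Finset.card_product, Nat.card_Icc, Finset.card_range,
      show m + 1 - (m - w) = w + 1 by omega, sq]
  have hlow : ∀ x ∈ Finset.Icc (m - w) m ×ˢ Finset.range (w + 1),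
      (r : ℝ) ^ 2 / 16 ≤ (((x.1 : ℤ) : ℝ)) ^ 2 + (((x.2 : ℤ) : ℝ)) ^ 2 := by
    intro x hx
    simp only [Finset.mem_product, Finset.mem_Icc, Finset.mem_range] at hx
    have : r ≤ 4 * x.1 := by omega
    have : (r : ℝ) ≤ 4 * x.1 := by exact_mod_cast this
    push_cast
    nlinarith [sq_nonneg (x.2 : ℝ), Nat.cast_nonneg (α := ℝ) r]
  have h1 := Finset.card_nsmul_le_sum _ _ _ hlow
  refine le_trans ?_ h1
  rw [hc, nsmul_eq_mul]
  have : r ≤ 8 * (w + 1) := by omega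
  have h8 : (r : ℝ) ≤ 8 * (w + 1) := by exact_mod_cast this
  have h64 : (r : ℝ) ^ 2 ≤ 64 * ((w : ℝ) + 1) ^ 2 := by
    nlinarith [Nat.cast_nonneg (α := ℝ) r]
  push_cast
  nlinarith [sq_nonneg (r : ℝ)]

/-- A radial potential, as a function of the squared distance. -/
def radialPot (s r q : ℝ) : ℝ := 2 * s ^ 2 * (Real.log (q - 5 * r ^ 2) - Real.log (r ^ 2)) - q

/-- The derivative 2s²/(q - 5r²) - 1 is nonnegative in this range. This lets the torus distance be
replaced by the larger planar one after a jump. -/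
lemma radialPot_mono {s r q q' : ℝ} (hr : 0 < r) (hq : 9 * r ^ 2 ≤ q) (hqq : q ≤ q')
    (hq' : q' ≤ 2 * s ^ 2) : radialPot s r q ≤ radialPot s r q' := by
  have hr2 : 0 < r ^ 2 := by positivity
  have hp : 0 < q - 5 * r ^ 2 := by linarith
  have hp' : 0 < q' - 5 * r ^ 2 := by linarith
  have h1 := Real.one_sub_inv_le_log_of_pos (div_pos hp' hp)
  rw [Real.log_div hp'.ne' hp.ne', inv_div] at h1
  have h2 : (q' - q) / (2 * s ^ 2) ≤ 1 - (q - 5 * r ^ 2) / (q' - 5 * r ^ 2) := by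
    rw [one_sub_div hp'.ne', show q' - 5 * r ^ 2 - (q - 5 * r ^ 2) = q' - q by ring]
    exact div_le_div_of_nonneg_left (by linarith) hp' (by linarith)
  have hs : 0 < 2 * s ^ 2 := by linarith
  have h3 := (div_le_iff₀ hs).1 (h2.trans h1)
  unfold radialPot
  linarith

/-- Here q - 5r² ≥ 4r² and log 4 > 1. The range starts at 9r² because a jump from outside radius 4r
may land at radius 3r; setting the potential to 0 near `u` therefore only lowers it. -/
lemma radialPot_nonneg {s r q : ℝ} (hr : 0 < r) (hq : 9 * r ^ 2 ≤ q) (hq' : q ≤ 2 * s ^ 2) :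
    0 ≤ radialPot s r q := by
  have hr2 : 0 < r ^ 2 := by positivity
  have h1 : Real.log (4 * r ^ 2) ≤ Real.log (q - 5 * r ^ 2) :=
    Real.log_le_log (by positivity) (by linarith)
  rw [Real.log_mul (by norm_num) hr2.ne'] at h1
  have h2 : Real.log 4 = 2 * Real.log 2 := by
    rw [show (4 : ℝ) = 2 ^ 2 by norm_num, Real.log_pow]
    norm_num
  have h3 : 1 ≤ Real.log (q - 5 * r ^ 2) - Real.log (r ^ 2) := by
    linarith [Real.log_two_gt_d9]
  unfold radialPot
  have : 2 * s ^ 2 * 1 ≤ 2 * s ^ 2 * (Real.log (q - 5 * r ^ 2) - Real.log (r ^ 2)) :=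
    mul_le_mul_of_nonneg_left h3 (by positivity)
  linarith

/-! ### The potential on the torus and the hitting time of a ball -/

section Torus

variable {s : ℕ}

/-- The square of the Euclidean distance on the torus. -/
def torusSq (v u : ZMod s × ZMod s) : ℝ :=
  ((v.1 - u.1).valMinAbs : ℝ) ^ 2 + ((v.2 - u.2).valMinAbs : ℝ) ^ 2

lemma torusSq_nonneg (v u : ZMod s × ZMod s) : 0 ≤ torusSq v u := by
  unfold torusSq
  positivity

open Classical in
/-- The potential on the torus whose drift controls the time to come close to `u`. -/
def meshPot (r : ℕ) (u v : ZMod s × ZMod s) : ℝ :=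
  if torusSq v u < 16 * (r : ℝ) ^ 2 then 0 else radialPot s r (torusSq v u)

lemma sq_intCast_le_sq_intCast {a b : ℤ} (h : a.natAbs ≤ b.natAbs) :
    (a : ℝ) ^ 2 ≤ (b : ℝ) ^ 2 := by
  have := Int.natAbs_le_iff_sq_le.1 h
  exact_mod_cast this

/-- The L₁ norm is at most √2 times the Euclidean norm, and 4√2 < 6. -/
lemma torusDist_le_of_torusSq_lt {r : ℕ} {v u : ZMod s × ZMod s}
    (h : torusSq v u < 16 * (r : ℝ) ^ 2) : torusDist v u ≤ 6 * r := by
  unfold torusSq at h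
  unfold torusDist
  set a := (v.1 - u.1).valMinAbs
  set b := (v.2 - u.2).valMinAbs
  have h1 : a ^ 2 + b ^ 2 < 16 * (r : ℤ) ^ 2 := by exact_mod_cast h
  rw [← Int.natAbs_sq a, ← Int.natAbs_sq b] at h1
  have h2 : a.natAbs ^ 2 + b.natAbs ^ 2 < 16 * r ^ 2 := by exact_mod_cast h1
  by_contra hcon
  push Not at hcon
  have h3 := Nat.pow_le_pow_left hcon.le 2
  zify at h2 h3
  nlinarith [sq_nonneg (|a| - |b|)]

variable [NeZero s]

lemma torusSq_le (v u : ZMod s × ZMod s) : torusSq v u ≤ (s : ℝ) ^ 2 / 2 := by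
  have key : ∀ z : ZMod s, (z.valMinAbs : ℝ) ^ 2 ≤ (s : ℝ) ^ 2 / 4 := by
    intro z
    have h := ZMod.natAbs_valMinAbs_le z
    have h2 : (2 * z.valMinAbs).natAbs ≤ (s : ℤ).natAbs := by omega
    have h3 := sq_intCast_le_sq_intCast h2
    push_cast at h3
    linarith
  have h1 := key (v.1 - u.1)
  have h2 := key (v.2 - u.2)
  unfold torusSq
  linarith

variable {r : ℕ}

lemma meshPot_nonneg (hr : 1 ≤ r) (u v : ZMod s × ZMod s) : 0 ≤ meshPot r u v := by
  have hr' : (1 : ℝ) ≤ r := by exact_mod_cast hr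
  unfold meshPot
  split_ifs with h
  · exact le_rfl
  · have := torusSq_le v u
    exact radialPot_nonneg (by linarith) (by nlinarith) (by nlinarith)

lemma meshPot_le (hr : 1 ≤ r) (hrs : r ≤ s) (u v : ZMod s × ZMod s) :
    meshPot r u v ≤ 2 * (s : ℝ) ^ 2 * Real.log ((s : ℝ) ^ 2 / (r : ℝ) ^ 2) := by
  have hr' : (1 : ℝ) ≤ r := by exact_mod_cast hr
  have hrs' : (r : ℝ) ≤ s := by exact_mod_cast hrs
  have hsq : (r : ℝ) ^ 2 ≤ (s : ℝ) ^ 2 := by gcongr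
  have hr2 : 0 < (r : ℝ) ^ 2 := by positivity
  unfold meshPot
  split_ifs with h
  · refine mul_nonneg (by positivity) (Real.log_nonneg ?_)
    rwa [one_le_div hr2]
  · have h1 := torusSq_le v u
    have h2 : Real.log (torusSq v u - 5 * (r : ℝ) ^ 2) ≤ Real.log ((s : ℝ) ^ 2) :=
      Real.log_le_log (by linarith) (by nlinarith)
    rw [Real.log_div (by linarith) hr2.ne']
    unfold radialPot
    have h3 : 2 * (s : ℝ) ^ 2 * (Real.log (torusSq v u - 5 * (r : ℝ) ^ 2) - Real.log ((r : ℝ) ^ 2)) ≤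
        2 * (s : ℝ) ^ 2 * (Real.log ((s : ℝ) ^ 2) - Real.log ((r : ℝ) ^ 2)) :=
      mul_le_mul_of_nonneg_left (by linarith) (by positivity)
    linarith [torusSq_nonneg v u]

lemma valMinAbs_intCast_of_abs_lt {i : ℤ} (h : 2 * i.natAbs < s) :
    ((i : ℤ) : ZMod s).valMinAbs = i := by
  rw [ZMod.valMinAbs_spec]
  refine ⟨rfl, ?_⟩
  rw [Set.mem_Ioc]
  omega

/-- For 2r < s the ball does not overlap itself around the torus, so it unfolds to the planar
diamond. -/
lemma sum_meshDst (hrs : 2 * r + 1 ≤ s) (f : ZMod s × ZMod s → ℝ) (v : ZMod s × ZMod s) :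
    ∑ y ∈ meshDst s r v, f y =
      ∑ y ∈ diamond r, f (v.1 + ((y.1 : ℤ) : ZMod s), v.2 + ((y.2 : ℤ) : ZMod s)) := by
  symm
  refine Finset.sum_nbij' (fun y => (v.1 + ((y.1 : ℤ) : ZMod s), v.2 + ((y.2 : ℤ) : ZMod s)))
    (fun x => ((x.1 - v.1).valMinAbs, (x.2 - v.2).valMinAbs)) ?_ ?_ ?_ ?_ ?_
  · intro y hy
    obtain ⟨h0, h1⟩ := mem_diamond.1 hy
    have e1 : (((y.1 : ℤ) : ZMod s)).valMinAbs = y.1 := valMinAbs_intCast_of_abs_lt (by omega)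
    have e2 : (((y.2 : ℤ) : ZMod s)).valMinAbs = y.2 := valMinAbs_intCast_of_abs_lt (by omega)
    rw [mem_meshDst]
    constructor
    · intro h
      apply h0
      have a1 : ((y.1 : ℤ) : ZMod s) = 0 := by simpa using congrArg Prod.fst h
      have a2 : ((y.2 : ℤ) : ZMod s) = 0 := by simpa using congrArg Prod.snd h
      rw [a1, ZMod.valMinAbs_zero] at e1
      rw [a2, ZMod.valMinAbs_zero] at e2
      exact Prod.ext e1.symm e2.symm
    · rw [torusDist_comm]
      simp only [torusDist, add_sub_cancel_left, e1, e2]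
      exact h1
  · intro x hx
    obtain ⟨h0, h1⟩ := mem_meshDst.1 hx
    rw [mem_diamond]
    constructor
    · intro h
      apply h0
      have a1 := congrArg Prod.fst h
      have a2 := congrArg Prod.snd h
      simp only [Prod.fst_zero, Prod.snd_zero, ZMod.valMinAbs_eq_zero, sub_eq_zero] at a1 a2
      exact Prod.ext a1 a2
    · rw [torusDist_comm] at h1
      exact h1
  · intro y hy
    obtain ⟨h0, h1⟩ := mem_diamond.1 hy
    have e1 : (((y.1 : ℤ) : ZMod s)).valMinAbs = y.1 := valMinAbs_intCast_of_abs_lt (by omega)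
    have e2 : (((y.2 : ℤ) : ZMod s)).valMinAbs = y.2 := valMinAbs_intCast_of_abs_lt (by omega)
    simp only [add_sub_cancel_left, e1, e2]
  · intro x _
    simp only [ZMod.coe_valMinAbs, add_sub_cancel]
  · intro _ _
    rfl

/-- `valMinAbs` has the least absolute value among all integer lifts. -/
lemma torusSq_add_le (v u : ZMod s × ZMod s) (y : ℤ × ℤ) :
    torusSq (v.1 + ((y.1 : ℤ) : ZMod s), v.2 + ((y.2 : ℤ) : ZMod s)) u ≤
      (((v.1 - u.1).valMinAbs : ℝ) + y.1) ^ 2 + (((v.2 - u.2).valMinAbs : ℝ) + y.2) ^ 2 := by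
  have key : ∀ (x z : ZMod s) (i : ℤ), ((x + (i : ZMod s) - z).valMinAbs : ℝ) ^ 2 ≤
      (((x - z).valMinAbs : ℝ) + i) ^ 2 := by
    intro x z i
    have h : (x + (i : ZMod s) - z).valMinAbs.natAbs ≤ ((x - z).valMinAbs + i).natAbs :=
      ZMod.natAbs_min_of_le_div_two s _ _ (by rw [ZMod.coe_valMinAbs, Int.cast_add, ZMod.coe_valMinAbs]; ring)
        (ZMod.natAbs_valMinAbs_le _)
    have := sq_intCast_le_sq_intCast h
    push_cast at this
    exact this
  exact add_le_add (key _ _ _) (key _ _ _)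

lemma meshPot_add_le (hr : 1 ≤ r) (hrs : 2 * r + 1 ≤ s) {u v : ZMod s × ZMod s}
    (h : 16 * (r : ℝ) ^ 2 ≤ torusSq v u) {y : ℤ × ℤ} (hy : y ∈ diamond r) :
    meshPot r u (v.1 + ((y.1 : ℤ) : ZMod s), v.2 + ((y.2 : ℤ) : ZMod s)) ≤
      radialPot s r
        ((((v.1 - u.1).valMinAbs : ℝ) + y.1) ^ 2 + (((v.2 - u.2).valMinAbs : ℝ) + y.2) ^ 2) := by
  have hr' : (1 : ℝ) ≤ r := by exact_mod_cast hr
  have hrs' : 2 * (r : ℝ) + 1 ≤ s := by exact_mod_cast hrs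
  have hys := sq_add_sq_le_of_mem_diamond hy
  have h9 := nine_mul_sq_le_of_jump (by linarith) h hys
  have hle := torusSq_add_le v u y
  have hv := torusSq_le v u
  have h2 : (((v.1 - u.1).valMinAbs : ℝ) + y.1) ^ 2 + (((v.2 - u.2).valMinAbs : ℝ) + y.2) ^ 2 ≤
      2 * (s : ℝ) ^ 2 := by
    unfold torusSq at hv
    nlinarith [sq_nonneg (((v.1 - u.1).valMinAbs : ℝ) - y.1),
      sq_nonneg (((v.2 - u.2).valMinAbs : ℝ) - y.2)]
  unfold meshPot
  split_ifs with hsmall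
  · exact radialPot_nonneg (by linarith) h9 h2
  · exact radialPot_mono (by linarith) (by nlinarith) hle h2

/-- The potential has negative drift away from `u`. -/
lemma jumpAvg_meshPot_le (hr : 1 ≤ r) (hrs : 2 * r + 1 ≤ s) {u v : ZMod s × ZMod s}
    (h : 16 * (r : ℝ) ^ 2 ≤ torusSq v u) :
    jumpAvg (meshDst s r) (meshPot r u) v ≤ meshPot r u v - (meshDst s r v).card / 82944 := by
  have hr' : (1 : ℝ) ≤ r := by exact_mod_cast hr
  have hcard : (meshDst s r v).card = (diamond r).card := by
    have := sum_meshDst hrs (fun _ => 1) v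
    simpa using this
  have hpos : (0 : ℝ) < (meshDst s r v).card := by
    exact_mod_cast (meshDst_nonempty (by omega) hr v).card_pos
  have hle : ((meshDst s r v).card : ℝ) ≤ 9 * (r : ℝ) ^ 2 := by
    exact_mod_cast card_meshDst_le hr v
  have hv : meshPot r u v = radialPot s r (torusSq v u) := by
    rw [meshPot, if_neg (not_lt.2 h)]
  rw [jumpAvg, div_le_iff₀ hpos, sum_meshDst hrs, hv]
  refine (Finset.sum_le_sum fun y hy => meshPot_add_le hr hrs h hy).trans ?_
  simp only [radialPot]
  rw [Finset.sum_sub_distrib, ← Finset.mul_sum, Finset.sum_sub_distrib, sum_diamond_sq,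
    Finset.sum_const, nsmul_eq_mul]
  have hlog := sum_diamond_log_le hr h
  -- As k ≤ 9r², the second moment sum r⁴/1024 is at least k²/(81 · 1024) = k²/82944; division by k
  -- gives the drift.
  have hsq := le_sum_diamond_sq hr
  rw [← hcard] at hlog ⊢
  have h1 := mul_le_mul_of_nonneg_left hlog (show 0 ≤ 2 * (s : ℝ) ^ 2 by positivity)
  have h2 : ((meshDst s r v).card : ℝ) * (meshDst s r v).card ≤
      9 * (r : ℝ) ^ 2 * (9 * (r : ℝ) ^ 2) := mul_le_mul hle hle hpos.le (by positivity)
  unfold torusSq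
  nlinarith

/-- Within a time of order `(n / k) log (n / k)` the walk comes within distance `r` of `u` with a
probability bounded below. -/
lemma avoidProb_ball_le (hs : 2 ≤ s) (hr : 1 ≤ r) {k J : ℕ}
    (hk : ∀ v : ZMod s × ZMod s, (meshDst s r v).card = k)
    (hJ : 331776 * ((s : ℝ) ^ 2 / k * Real.log (9 * ((s : ℝ) ^ 2 / k))) ≤ J)
    (u v : ZMod s × ZMod s) :
    avoidProb (meshDst s r) {x | torusDist x u ≤ r} (J + 21) v ≤ 1 - (1 / 576 : ℝ) ^ 20 / 2 := by
  have hd : ∀ v, (meshDst s r v).Nonempty := meshDst_nonempty hs hr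
  by_cases hrs : 2 * r + 1 ≤ s
  · have hr' : (1 : ℝ) ≤ r := by exact_mod_cast hr
    have hs' : (0 : ℝ) < (s : ℝ) ^ 2 := by positivity
    have hr2 : (0 : ℝ) < (r : ℝ) ^ 2 := by positivity
    have hk0 : (0 : ℝ) < k := by
      rw [← hk v]
      exact_mod_cast (hd v).card_pos
    have hk9 : (k : ℝ) ≤ 9 * (r : ℝ) ^ 2 := by
      rw [← hk v]
      exact_mod_cast card_meshDst_le hr v
    have hks : (k : ℝ) < (s : ℝ) ^ 2 := by
      rw [← hk v]
      exact_mod_cast card_meshDst_lt v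
    have hdrift := mul_avoidProb_le_of_drift (A := {x | torusSq x u < 16 * (r : ℝ) ^ 2}) hd
      (h := meshPot r u) (c := k / 82944) (by positivity) (meshPot_nonneg hr u)
      (fun x hx => by
        have := jumpAvg_meshPot_le hr hrs (not_lt.1 hx)
        rwa [hk x] at this) J v
    have hlog : Real.log ((s : ℝ) ^ 2 / (r : ℝ) ^ 2) ≤ Real.log (9 * ((s : ℝ) ^ 2 / k)) := by
      refine Real.log_le_log (by positivity) ?_
      rw [div_le_iff₀ hr2, ← mul_div_assoc, div_mul_eq_mul_div, le_div_iff₀ hk0]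
      nlinarith
    have hpot := meshPot_le hr (by omega) u v
    have hlogpos : 0 < Real.log (9 * ((s : ℝ) ^ 2 / k)) := by
      refine Real.log_pos ?_
      have : 1 < (s : ℝ) ^ 2 / k := (one_lt_div hk0).2 hks
      linarith
    have hJ0 : (0 : ℝ) < J := lt_of_lt_of_le (by positivity) hJ
    -- The constant in `hJ` is 331776 = 4 · 82944: the factor 2 of the potential, and another 2 to
    -- get probability 1/2.
    have hhalf : avoidProb (meshDst s r) {x | torusSq x u < 16 * (r : ℝ) ^ 2} J v ≤ 1 / 2 := by
      set α := avoidProb (meshDst s r) {x | torusSq x u < 16 * (r : ℝ) ^ 2} J v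
      have h1 : 2 * (s : ℝ) ^ 2 * Real.log ((s : ℝ) ^ 2 / (r : ℝ) ^ 2) ≤
          2 * (s : ℝ) ^ 2 * Real.log (9 * ((s : ℝ) ^ 2 / k)) :=
        mul_le_mul_of_nonneg_left hlog (by positivity)
      have h2 : 2 * (s : ℝ) ^ 2 * Real.log (9 * ((s : ℝ) ^ 2 / k)) ≤ k / 82944 * J * (1 / 2) := by
        have h3 := mul_le_mul_of_nonneg_left hJ (show (0 : ℝ) ≤ k / 82944 * (1 / 2) by positivity)
        have e : (k : ℝ) / 82944 * (1 / 2) *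
            (331776 * ((s : ℝ) ^ 2 / k * Real.log (9 * ((s : ℝ) ^ 2 / k)))) =
            2 * (s : ℝ) ^ 2 * Real.log (9 * ((s : ℝ) ^ 2 / k)) := by
          generalize Real.log (9 * ((s : ℝ) ^ 2 / k)) = ℓ
          field_simp
          norm_num
        linarith
      have h4 : (k : ℝ) / 82944 * J * α ≤ k / 82944 * J * (1 / 2) := by linarith
      exact le_of_mul_le_mul_left h4 (by positivity)
    have hreach := avoidProb_add_le_of_reach (A := {x | torusSq x u < 16 * (r : ℝ) ^ 2}) hd
      (fun x hx => avoidProb_ball_le_of_torusDist_le hd hr (torusDist_le_of_torusSq_lt hx)) J v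
    have hp : (0 : ℝ) ≤ (1 / 576 : ℝ) ^ 20 := by positivity
    nlinarith
  -- Now s ≤ 2r, so every vertex is already within 6r of `u`.
  · have h1 := avoidProb_ball_le_of_torusDist_le hd hr (u := u) (v := v)
      ((torusDist_le v u).trans (by omega))
    have h2 := chainProb_antitone hd (fun x _ => x ∉ {x | torusDist x u ≤ r}) v
      (show 21 ≤ J + 21 by omega)
    have hp : (0 : ℝ) ≤ (1 / 576 : ℝ) ^ 20 := by positivity
    have h3 : avoidProb (meshDst s r) {x | torusDist x u ≤ r} (J + 21) v ≤
      avoidProb (meshDst s r) {x | torusDist x u ≤ r} 21 v := h2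
    linarith

end Torus

/-! ### Hops of nearly full range, the union bound and the final constants -/

lemma ENNReal.tsum_pow_div (M : ℕ) [NeZero M] :
    ∑' t : ℕ, ENNReal.ofReal ((1 / 2 : ℝ) ^ (t / M)) = ENNReal.ofReal (2 * M) := by
  have h1 : ∑' t : ℕ, ENNReal.ofReal ((1 / 2 : ℝ) ^ (t / M)) =
      ∑' x : ℕ × Fin M, ENNReal.ofReal ((1 / 2 : ℝ) ^ x.1) :=
    (Nat.divModEquiv M).tsum_eq (fun x : ℕ × Fin M => ENNReal.ofReal ((1 / 2 : ℝ) ^ x.1))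
  rw [h1, ENNReal.tsum_prod (f := fun i (_ : Fin M) => ENNReal.ofReal ((1 / 2 : ℝ) ^ i))]
  simp only [ENNReal.tsum_const, ENat.card_eq_coe_fintype_card, Fintype.card_fin]
  rw [ENNReal.tsum_mul_left, ← ENNReal.ofReal_tsum_of_nonneg (fun _ => by positivity)
    summable_geometric_two, tsum_geometric_two, mul_comm (2 : ℝ),
    ENNReal.ofReal_mul (Nat.cast_nonneg _), ENNReal.ofReal_natCast]
  simp

section Torus

variable {s : ℕ}

/-- A geodesic triangle on a cycle of length s has perimeter at most s. The lifts shifted by 0, s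
and -s are the only ones needed. -/
lemma ZMod.natAbs_valMinAbs_sub_add_le [NeZero s] (a b u : ZMod s) :
    (a - b).valMinAbs.natAbs + (a - u).valMinAbs.natAbs + (b - u).valMinAbs.natAbs ≤ s := by
  have key : ∀ j : ℤ, (a - b).valMinAbs.natAbs ≤
      ((a - u).valMinAbs - (b - u).valMinAbs + s * j).natAbs := fun j =>
    ZMod.natAbs_min_of_le_div_two s _ _ (by
      push_cast
      simp only [ZMod.natCast_self]
      ring) (ZMod.natAbs_valMinAbs_le _)
  have h0 := key 0
  have h1 := key 1
  have h2 := key (-1)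
  have ha := ZMod.natAbs_valMinAbs_le (a - u)
  have hb := ZMod.natAbs_valMinAbs_le (b - u)
  omega

variable [NeZero s]

/-- Two vertices that do not reach `u` are close to each other. -/
lemma torusDist_add_le {r : ℕ} {a b u : ZMod s × ZMod s} (ha : r < torusDist a u)
    (hb : r < torusDist b u) : torusDist a b + 2 * (r + 1) ≤ 2 * s := by
  have h1 := ZMod.natAbs_valMinAbs_sub_add_le a.1 b.1 u.1
  have h2 := ZMod.natAbs_valMinAbs_sub_add_le a.2 b.2 u.2
  unfold torusDist at *
  omega

open Classical in
lemma card_filter_torusDist_le (ρ : ℕ) (v : ZMod s × ZMod s) :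
    (Finset.univ.filter fun u => torusDist v u ≤ ρ).card ≤ (2 * ρ + 1) ^ 2 := by
  have h : (Finset.univ.filter fun u => torusDist v u ≤ ρ).card ≤
      (Finset.Icc (-ρ : ℤ) ρ ×ˢ Finset.Icc (-ρ : ℤ) ρ).card := by
    refine Finset.card_le_card_of_injOn
      (fun u => ((v.1 - u.1).valMinAbs, (v.2 - u.2).valMinAbs)) ?_ ?_
    · intro u hu
      have := (Finset.mem_filter.1 (Finset.mem_coe.1 hu)).2
      unfold torusDist at this
      simp only [Finset.coe_product, Finset.coe_Icc, Set.mem_prod, Set.mem_Icc]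
      omega
    · intro x _ y _ hxy
      have h1 := ZMod.injective_valMinAbs (Prod.mk.inj hxy).1
      have h2 := ZMod.injective_valMinAbs (Prod.mk.inj hxy).2
      exact Prod.ext (sub_right_injective h1) (sub_right_injective h2)
  refine h.trans ?_
  simp only [Finset.card_product, Int.card_Icc]
  have e : ((ρ : ℤ) + 1 - -ρ).toNat = 2 * ρ + 1 := by omega
  rw [e, sq]

open Classical in
lemma card_meshDst_add_card_far (r : ℕ) (v : ZMod s × ZMod s) :
    (meshDst s r v).card + 1 + (Finset.univ.filter fun u => r < torusDist v u).card = s ^ 2 := by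
  have h1 : (Finset.univ.filter fun u => torusDist v u ≤ r) = insert v (meshDst s r v) := by
    ext u
    by_cases h : u = v
    · simp [h, torusDist_self]
    · simp [h, mem_meshDst]
  have h2 : (insert v (meshDst s r v)).card = (meshDst s r v).card + 1 :=
    Finset.card_insert_of_notMem (by simp [mem_meshDst])
  have h3 := Finset.card_filter_add_card_filter_not (s := (Finset.univ : Finset (ZMod s × ZMod s)))
    (fun u => torusDist v u ≤ r)
  rw [h1, h2] at h3
  simp only [not_le] at h3
  rw [h3]
  simp [ZMod.card, sq]

open Classical in
lemma card_filter_le_of_pairwise_near {r : ℕ} (T : Finset (ZMod s × ZMod s))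
    (v : ZMod s × ZMod s) (hT : ∀ y ∈ T, torusDist v y + 2 * (r + 1) ≤ 2 * s)
    (hrs : 20 * (s - r) ≤ s) : 25 * T.card ≤ s ^ 2 := by
  rcases T.eq_empty_or_nonempty with rfl | ⟨y, hy⟩
  · simp
  -- An element of `T` forces r < s, so the natural subtractions below are not truncated.
  have hy' := hT y hy
  have h1 : T.card ≤ (2 * (2 * s - 2 * (r + 1)) + 1) ^ 2 := by
    refine le_trans (Finset.card_le_card fun z hz => ?_)
      (card_filter_torusDist_le (2 * s - 2 * (r + 1)) v)
    have := hT z hz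
    rw [Finset.mem_filter]
    exact ⟨Finset.mem_univ _, by omega⟩
  have h2 : 5 * (2 * (2 * s - 2 * (r + 1)) + 1) ≤ s := by omega
  have h3 := Nat.pow_le_pow_left h2 2
  nlinarith

open Classical in
/-- If the range of the hops is close to `s`, two random consecutive transmissions leave no vertex
uninformed with probability at least one half. -/
lemma chainProb_unheard_le (hs : 3 ≤ s) {r : ℕ} (hr : 1 ≤ r) (hrs : 20 * (s - r) ≤ s)
    (v : ZMod s × ZMod s) :
    chainProb (meshDst s r) (fun x y => ∃ u, r < torusDist x u ∧ r < torusDist y u) 1 v ≤ 1 / 2 := by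
  have hpos : (0 : ℝ) < (meshDst s r v).card := by
    exact_mod_cast (meshDst_nonempty (by omega) hr v).card_pos
  suffices h : ∀ R : ZMod s × ZMod s → ZMod s × ZMod s → Prop,
      (∀ y, R v y → ∃ u, r < torusDist v u ∧ r < torusDist y u) →
        chainProb (meshDst s r) R 1 v ≤ 1 / 2 from h _ fun _ h => h
  intro R hR
  rw [chainProb_one, div_le_iff₀ hpos]
  set T := (meshDst s r v).filter (R v)
  -- If `v` and `y` both miss some `u`, then `y` is close to `v`, so the bad destinations `T` form
  -- at most n/25 vertices. Likewise the vertices `D` missed by `v` are close to one another, so `v`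
  -- has at least 24n/25 - 1 destinations.
  set D := Finset.univ.filter fun u => r < torusDist v u with hD
  have hT : 25 * T.card ≤ s ^ 2 := by
    refine card_filter_le_of_pairwise_near T v (fun y hy => ?_) hrs
    obtain ⟨u, h1, h2⟩ := hR y (Finset.mem_filter.1 hy).2
    exact torusDist_add_le h1 h2
  have hDc : 25 * D.card ≤ s ^ 2 := by
    rcases D.eq_empty_or_nonempty with h | ⟨d, hd⟩
    · simp [h]
    · refine card_filter_le_of_pairwise_near D d (fun y hy => ?_) hrs
      have h1 := (Finset.mem_filter.1 hy).2
      have h2 := (Finset.mem_filter.1 hd).2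
      rw [torusDist_comm] at h1 h2
      exact torusDist_add_le h2 h1
  have hadd : (meshDst s r v).card + 1 + D.card = s ^ 2 := by
    convert card_meshDst_add_card_far r v
  have h9 := Nat.pow_le_pow_left hs 2
  have : 2 * T.card ≤ (meshDst s r v).card := by omega
  have : 2 * (T.card : ℝ) ≤ (meshDst s r v).card := by exact_mod_cast this
  linarith

/-- If the range of the hops is not close to `s`, a positive fraction of the vertices is not
reached. -/
lemma card_meshDst_le_of_lt {r : ℕ} (hrs : s < 20 * (s - r)) (v : ZMod s × ZMod s) :
    1600 * (meshDst s r v).card ≤ 1599 * s ^ 2 := by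
  classical
  have hlt := card_meshDst_lt (r := r) v
  rcases lt_or_ge s 40 with hs | hs
  -- For s² ≤ 1600 it is enough that `v` is not its own destination.
  · have := Nat.pow_le_pow_left hs.le 2
    omega
  -- Vertices that differ from `v` by at least `L` in both coordinates are out of range; they form a
  -- square of side s - 2L + 1 ≥ s/40.
  set L := r / 2 + 1 with hL
  have hfar : ((Finset.Icc L (s - L)) ×ˢ (Finset.Icc L (s - L))).card ≤
      (Finset.univ.filter fun u => r < torusDist v u).card := by
    have hval : ∀ i ∈ Finset.Icc L (s - L), ((i : ZMod s)).val = i := by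
      intro i hi
      rw [Finset.mem_Icc] at hi
      exact ZMod.val_cast_of_lt (by omega)
    have habs : ∀ i ∈ Finset.Icc L (s - L), L ≤ ((i : ZMod s)).valMinAbs.natAbs := by
      intro i hi
      rw [ZMod.valMinAbs_natAbs_eq_min, hval i hi]
      rw [Finset.mem_Icc] at hi
      omega
    refine Finset.card_le_card_of_injOn (fun x => (v.1 - (x.1 : ZMod s), v.2 - (x.2 : ZMod s)))
      ?_ ?_
    · intro x hx
      obtain ⟨h1, h2⟩ := Finset.mem_product.1 hx
      have a1 := habs _ h1
      have a2 := habs _ h2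
      rw [Finset.mem_coe, Finset.mem_filter]
      refine ⟨Finset.mem_univ _, ?_⟩
      simp only [torusDist, sub_sub_cancel]
      omega
    · intro x hx y hy hxy
      obtain ⟨h1, h2⟩ := Finset.mem_product.1 hx
      obtain ⟨h3, h4⟩ := Finset.mem_product.1 hy
      have e1 := congrArg ZMod.val (sub_right_injective (Prod.mk.inj hxy).1)
      have e2 := congrArg ZMod.val (sub_right_injective (Prod.mk.inj hxy).2)
      rw [hval _ h1, hval _ h3] at e1
      rw [hval _ h2, hval _ h4] at e2
      exact Prod.ext e1 e2
  have hadd := card_meshDst_add_card_far r v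
  rw [Finset.card_product, Nat.card_Icc] at hfar
  have h40 : s ≤ 40 * (s - L + 1 - L) := by omega
  have := Nat.mul_le_mul h40 h40
  nlinarith

lemma lintegral_radioCoverRandomTime_le_of_pow {r M : ℕ} [NeZero M] (v : ZMod s × ZMod s)
    (h : ∀ t : ℕ, (torusMesh s r).walkMeasure v
      {ω | ∃ u, ∀ i < t + 1, ¬ (ω i).arc.Incident u} ≤ ENNReal.ofReal ((1 / 2 : ℝ) ^ (t / M))) :
    ∫⁻ ω, radioCoverRandomTime ω ∂((torusMesh s r).walkMeasure v) ≤ ENNReal.ofReal (2 * M) := by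
  rw [← ENNReal.tsum_pow_div]
  exact (DirectedHypergraph.lintegral_radioCoverRandomTime_le _ v).trans (ENNReal.tsum_le_tsum h)

lemma radioCoverTime_le_two (hs : 3 ≤ s) {r : ℕ} (hr : 1 ≤ r) (hrs : 20 * (s - r) ≤ s) :
    (torusMesh s r).radioCoverTime ≤ ENNReal.ofReal 2 := by
  refine iSup_le fun v => ?_
  have hd : ∀ v, (meshDst s r v).Nonempty := meshDst_nonempty (by omega) hr
  have hb : ∀ t : ℕ, (torusMesh s r).walkMeasure v
      {ω | ∃ u, ∀ i < t + 1, ¬ (ω i).arc.Incident u} ≤ ENNReal.ofReal ((1 / 2 : ℝ) ^ (t / 1)) := by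
    intro t
    -- The relation looks at both ends of a step, so `t` steps cover the times 0 to t.
    have h1 := DirectedHypergraph.walkMeasure_chain (torusMesh s r).toDirectedHypergraph
      (stateLaw_torusMesh hd) (fun x y => ∃ u, ¬ x.arc.Incident u ∧ ¬ y.arc.Incident u) t v
    simp only [incident_meshArc_iff, not_le] at h1
    have hsub : {ω : ℕ → WalkState (ZMod s × ZMod s) |
        ∃ u, ∀ i < t + 1, ¬ (ω i).arc.Incident u} ⊆
        {ω | ∀ i < t, ∃ u, ¬ (ω i).arc.Incident u ∧ ¬ (ω (i + 1)).arc.Incident u} := by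
      rintro ω ⟨u, hu⟩ i hi
      exact ⟨u, hu i (by omega), hu (i + 1) (by omega)⟩
    refine (measure_mono hsub).trans ?_
    rw [h1, Nat.div_one]
    refine ENNReal.ofReal_le_ofReal ?_
    have h2 := chainProb_mul_le_pow hd (by norm_num) (chainProb_unheard_le hs hr hrs) t 0 v
    rw [mul_one, add_zero] at h2
    exact h2
  have key := lintegral_radioCoverRandomTime_le_of_pow (M := 1) v hb
  rwa [Nat.cast_one, mul_one] at key

/-- Union bound over the vertices: if each vertex hears the walk within `M` steps with probability
at least `1 - γ` from any start, then all of them do so within `2 i M` steps on average as soon as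
`2 n γ ^ i ≤ 1`. -/
lemma radioCoverTime_le_of_avoidProb_le {r M i : ℕ} [NeZero M] [NeZero i] {γ : ℝ} (hγ : 0 ≤ γ)
    (hd : ∀ v, (meshDst s r v).Nonempty)
    (h : ∀ u v : ZMod s × ZMod s, avoidProb (meshDst s r) {x | torusDist x u ≤ r} M v ≤ γ)
    (hi : 2 * (s : ℝ) ^ 2 * γ ^ i ≤ 1) :
    (torusMesh s r).radioCoverTime ≤ ENNReal.ofReal (2 * (i * M : ℕ)) := by
  refine iSup_le fun v => lintegral_radioCoverRandomTime_le_of_pow (M := i * M) v fun t => ?_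
  set l := t / (i * M) with hl
  rcases Nat.eq_zero_or_pos l with h0 | h0
  · rw [h0]
    simpa using prob_le_one (μ := (torusMesh s r).walkMeasure v)
  have hu : ∀ u, (torusMesh s r).walkMeasure v {ω | ∀ j < t + 1, ¬ (ω j).arc.Incident u} ≤
      ENNReal.ofReal ((γ ^ i) ^ l) := by
    intro u
    -- The relation looks only at the start of a step, so t + 1 steps are needed to cover the times
    -- 0 to t.
    have h1 := DirectedHypergraph.walkMeasure_chain (torusMesh s r).toDirectedHypergraph
      (stateLaw_torusMesh hd) (fun x _ => ¬ x.arc.Incident u) (t + 1) v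
    rw [h1]
    simp only [incident_meshArc_iff]
    refine ENNReal.ofReal_le_ofReal ?_
    rw [← pow_mul]
    have e : i * l * M + (t + 1 - i * l * M) = t + 1 := by
      have : l * (i * M) ≤ t := Nat.div_mul_le_self t (i * M)
      have : i * l * M = l * (i * M) := by ring
      omega
    rw [← e]
    exact chainProb_mul_le_pow hd hγ (h u) (i * l) _ v
  have hset : {ω : ℕ → WalkState (ZMod s × ZMod s) | ∃ u, ∀ j < t + 1, ¬ (ω j).arc.Incident u} =
      ⋃ u, {ω | ∀ j < t + 1, ¬ (ω j).arc.Incident u} := by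
    ext ω
    simp
  rw [hset]
  refine (measure_iUnion_fintype_le _ _).trans ((Finset.sum_le_sum fun u _ => hu u).trans ?_)
  rw [Finset.sum_const, nsmul_eq_mul, ← ENNReal.ofReal_natCast,
    ← ENNReal.ofReal_mul (Nat.cast_nonneg _)]
  refine ENNReal.ofReal_le_ofReal ?_
  have hs : (1 : ℝ) ≤ (s : ℝ) ^ 2 := by
    exact_mod_cast Nat.one_le_pow _ _ (Nat.pos_of_ne_zero (NeZero.ne s))
  have hcard : ((Finset.univ : Finset (ZMod s × ZMod s)).card : ℝ) = (s : ℝ) ^ 2 := by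
    simp [ZMod.card, sq]
  rw [hcard]
  clear_value l
  -- One of the `l` factors γ^i pays for the s² terms of the union bound.
  obtain ⟨m, rfl⟩ : ∃ m, l = m + 1 := ⟨l - 1, by omega⟩
  have hγi : 0 ≤ γ ^ i := pow_nonneg hγ i
  have h2 : γ ^ i ≤ 1 / 2 := by nlinarith
  have h3 := pow_le_pow_left₀ hγi h2 m
  rw [pow_succ (γ ^ i), pow_succ (1 / 2 : ℝ)]
  have h4 : (s : ℝ) ^ 2 * γ ^ i ≤ 1 / 2 := by linarith
  calc (s : ℝ) ^ 2 * ((γ ^ i) ^ m * γ ^ i) = (γ ^ i) ^ m * ((s : ℝ) ^ 2 * γ ^ i) := by ring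
    _ ≤ _ := mul_le_mul h3 h4 (by positivity) (by positivity)

/-- The cover time is of order `(n / k) log (n / k) log n` when a positive fraction of the vertices
is not reached. -/
lemma exists_radioCoverTime_le {ε : ℝ} (hε : 0 < ε) : ∃ C : ℝ, 0 < C ∧
    ∀ (s r k : ℕ) [NeZero s], 2 ≤ s → 1 ≤ r →
      (∀ v : ZMod s × ZMod s, (meshDst s r v).card = k) → (k : ℝ) ≤ (1 - ε) * (s : ℝ) ^ 2 →
      (torusMesh s r).radioCoverTime ≤ ENNReal.ofReal
        (C * ((s : ℝ) ^ 2 / k * Real.log ((s : ℝ) ^ 2 / k) * Real.log ((s : ℝ) ^ 2))) := by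
  set γ : ℝ := 1 - (1 / 576 : ℝ) ^ 20 / 2 with hγ
  have hγ0 : 0 < γ := by rw [hγ]; norm_num
  have hγ1 : γ < 1 := by rw [hγ]; norm_num
  have hlγ : 0 < -Real.log γ := by linarith [Real.log_neg hγ0 hγ1]
  -- With x = n/k and y = x log x, both log x and y are at least ε. Thus 3/ε · log x absorbs log 9 ≤
  -- 3, and 22/ε · y absorbs the 21 extra steps and the rounding of `J`. `B` counts the rounds:
  -- log(2n)/(-log γ) of them, rounded up, make 2nγ^i ≤ 1.
  set A : ℝ := 331776 * (1 + 3 / ε) + 22 / ε with hA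
  set B : ℝ := 2 / (-Real.log γ) + 1 with hB
  have hA0 : 0 < A := by positivity
  have hB0 : 0 < B := by positivity
  refine ⟨2 * (B * A), by positivity, fun s r k _ hs hr hk hkε => ?_⟩
  have hd : ∀ v, (meshDst s r v).Nonempty := meshDst_nonempty hs hr
  have hk0 : (0 : ℝ) < k := by
    rw [← hk 0]
    exact_mod_cast (hd 0).card_pos
  have hs4 : (4 : ℝ) ≤ (s : ℝ) ^ 2 := by exact_mod_cast Nat.pow_le_pow_left hs 2
  set x : ℝ := (s : ℝ) ^ 2 / k with hx
  have hx0 : 0 < x := by positivity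
  have hxinv : x⁻¹ ≤ 1 - ε := by
    rw [hx, inv_div, div_le_iff₀ (by positivity)]
    exact hkε
  have hlogx : ε ≤ Real.log x := by linarith [Real.one_sub_inv_le_log_of_pos hx0]
  have hx1 : 1 ≤ x := by
    have : x⁻¹ ≤ 1 := by linarith
    exact (inv_le_one₀ hx0).1 this
  set n : ℝ := (s : ℝ) ^ 2 with hn
  have hlogn : 1 ≤ Real.log n := by
    have h1 : Real.log 4 ≤ Real.log n := Real.log_le_log (by norm_num) hs4
    have h2 : Real.log 4 = 2 * Real.log 2 := by
      rw [show (4 : ℝ) = 2 ^ 2 by norm_num, Real.log_pow]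
      norm_num
    linarith [Real.log_two_gt_d9]
  set y : ℝ := x * Real.log x with hy
  have hyε : ε ≤ y := by nlinarith
  set J := ⌈331776 * (x * Real.log (9 * x))⌉₊ with hJ
  have hlog9 : Real.log (9 * x) ≤ (1 + 3 / ε) * Real.log x := by
    rw [Real.log_mul (by norm_num) hx0.ne']
    have h9 : Real.log 9 ≤ 3 := by
      have h1 : Real.log 9 ≤ Real.log (2 ^ 4) := Real.log_le_log (by norm_num) (by norm_num)
      rw [Real.log_pow] at h1
      push_cast at h1
      linarith [Real.log_two_lt_d9]
    have h3 : 3 ≤ 3 / ε * Real.log x := by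
      rw [div_mul_eq_mul_div, le_div_iff₀ hε]
      linarith
    linarith
  have hJle : ((J + 21 : ℕ) : ℝ) ≤ A * y := by
    have h1 : 0 ≤ Real.log (9 * x) := Real.log_nonneg (by linarith)
    have h2 : (J : ℝ) < 331776 * (x * Real.log (9 * x)) + 1 := Nat.ceil_lt_add_one (by positivity)
    have h3 : x * Real.log (9 * x) ≤ (1 + 3 / ε) * y := by
      rw [hy]
      nlinarith
    have h4 : 22 ≤ 22 / ε * y := by
      rw [div_mul_eq_mul_div, le_div_iff₀ hε]
      linarith
    push_cast
    rw [hA, add_mul]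
    linarith
  set i := ⌈Real.log (2 * n) / (-Real.log γ)⌉₊ with hi
  have hlog2n : 0 < Real.log (2 * n) := Real.log_pos (by linarith)
  have hipos : 0 < i := Nat.ceil_pos.2 (div_pos hlog2n hlγ)
  have hile : (i : ℝ) ≤ B * Real.log n := by
    have h1 : (i : ℝ) < Real.log (2 * n) / (-Real.log γ) + 1 :=
      Nat.ceil_lt_add_one (div_pos hlog2n hlγ).le
    have h2 : Real.log (2 * n) ≤ 2 * Real.log n := by
      rw [Real.log_mul (by norm_num) (by linarith)]
      linarith [Real.log_two_lt_d9]
    have h3 : Real.log (2 * n) / (-Real.log γ) ≤ 2 * Real.log n / (-Real.log γ) :=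
      div_le_div_of_nonneg_right h2 hlγ.le
    have e : B * Real.log n = 2 * Real.log n / (-Real.log γ) + Real.log n := by
      rw [hB]
      ring
    rw [e]
    linarith
  have hγi : 2 * n * γ ^ i ≤ 1 := by
    have h1 : Real.log (2 * n) / (-Real.log γ) ≤ i := Nat.le_ceil _
    rw [div_le_iff₀ hlγ] at h1
    have h2 : Real.log (2 * n * γ ^ i) ≤ 0 := by
      rw [Real.log_mul (by positivity) (by positivity), Real.log_pow]
      linarith
    exact (Real.log_nonpos_iff (by positivity)).1 h2
  have : NeZero i := ⟨hipos.ne'⟩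
  refine (radioCoverTime_le_of_avoidProb_le (M := J + 21) (i := i) hγ0.le hd
    (avoidProb_ball_le hs hr hk (Nat.le_ceil _)) hγi).trans (ENNReal.ofReal_le_ofReal ?_)
  have h5 : (i : ℝ) * ((J + 21 : ℕ) : ℝ) ≤ B * Real.log n * (A * y) :=
    mul_le_mul hile hJle (Nat.cast_nonneg _) (by positivity)
  rw [Nat.cast_mul]
  linarith

end Torus

end

theorem mainTheorem7 :
    (∀ ε : ℝ, 0 < ε → ∃ C : ℝ, 0 < C ∧
      ∀ (n s r k : ℕ) [NeZero s], n = s ^ 2 → 1 ≤ r → (torusMesh s r).IsUniform k →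
        4 ≤ k → (k : ℝ) ≤ (1 - ε) * n →
        (torusMesh s r).radioCoverTime ≤
          ENNReal.ofReal (C * ((n / k : ℝ) * Real.log (n / k : ℝ) * Real.log n))) ∧
    (∃ C : ℝ, 0 < C ∧
      ∀ (n s r k : ℕ) [NeZero s], n = s ^ 2 → 1 ≤ r → (torusMesh s r).IsUniform k →
        4 ≤ k → k ≤ n →
        (torusMesh s r).radioCoverTime ≤
          ENNReal.ofReal (C * max 1 ((n / k : ℝ) * Real.log (n / k : ℝ) * Real.log n))) := by
  have two_le : ∀ s k : ℕ, 4 ≤ k → k ≤ s ^ 2 → 2 ≤ s := by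
    intro s k h4 hk
    by_contra hs
    have : s ^ 2 ≤ 1 := by nlinarith
    omega
  refine ⟨fun ε hε => ?_, ?_⟩
  · obtain ⟨C, hC, h⟩ := exists_radioCoverTime_le hε
    refine ⟨C, hC, ?_⟩
    rintro n s r k _ rfl hr hu h4 hk
    have hks : k ≤ s ^ 2 := by
      have : (k : ℝ) ≤ ((s ^ 2 : ℕ) : ℝ) :=
        hk.trans (by nlinarith [Nat.cast_nonneg (α := ℝ) (s ^ 2)])
      exact_mod_cast this
    have hs := two_le s k h4 hks
    push_cast at hk ⊢
    exact h s r k hs hr (card_meshDst_of_isUniform (meshDst_nonempty hs hr) hu) hk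
  · obtain ⟨C, hC, h⟩ := exists_radioCoverTime_le (ε := 1 / 1600) (by norm_num)
    refine ⟨max C 2, by positivity, ?_⟩
    rintro n s r k _ rfl hr hu h4 hks
    have hs := two_le s k h4 hks
    have hcard := card_meshDst_of_isUniform (meshDst_nonempty hs hr) hu
    by_cases hrs : 20 * (s - r) ≤ s
    · have hs3 : 3 ≤ s := by
        -- The case s = 2 is excluded because k < s² would contradict k ≥ 4.
        have h1 := card_meshDst_lt (r := r) (0 : ZMod s × ZMod s)
        rw [hcard] at h1
        by_contra hs3
        have : s = 2 := by omega
        subst this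
        omega
      refine (radioCoverTime_le_two hs3 hr hrs).trans (ENNReal.ofReal_le_ofReal ?_)
      nlinarith [le_max_right C 2, le_max_left 1 (((s ^ 2 : ℕ) / k : ℝ) *
        Real.log ((s ^ 2 : ℕ) / k : ℝ) * Real.log ((s ^ 2 : ℕ) : ℝ))]
    · have hk : (k : ℝ) ≤ (1 - 1 / 1600) * (s : ℝ) ^ 2 := by
        have h1 := card_meshDst_le_of_lt (not_le.1 hrs) (0 : ZMod s × ZMod s)
        rw [hcard] at h1
        have h2 : 1600 * (k : ℝ) ≤ 1599 * (s : ℝ) ^ 2 := by exact_mod_cast h1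
        linarith
      refine (h s r k hs hr hcard hk).trans (ENNReal.ofReal_le_ofReal ?_)
      push_cast
      set z := (s : ℝ) ^ 2 / k * Real.log ((s : ℝ) ^ 2 / k) * Real.log ((s : ℝ) ^ 2)
      calc C * z ≤ C * max 1 z := mul_le_mul_of_nonneg_left (le_max_right _ _) hC.le
        _ ≤ max C 2 * max 1 z := mul_le_mul_of_nonneg_right (le_max_left _ _) (by positivity)
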